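/- **Proposition 2.1 (Essential field equations of $f(R)$ gravity).** *Setting.* Let $\kappa>0$, let $I\subseteq\mathbb R$ be open (for instance $I=\mathbb R$), let $f$ be of class $C^2$ on $I$ with $f'>0$ on $I$ and $f'$ injective on $I$, and let $U:\mathbb R\to\mathbb R$ be differentiable. Let $R_\star$ be the inverse of $I\ni R\mapsto\frac1\kappa\log f'(R)$ and set $$V_\star(\rho)=\tfrac12R_\star(\rho)f'(R_\star(\rho))-\tfrac12 f(R_\star(\rho)),\qquad W_\star(\rho)=\frac{2f(R_\star(\rho))-R_\star(\rho)e^{\kappa\rho}}{6e^{2\kappa\rho}} .$$ Let $\Omega\subseteq\mathbb R\times(0,\infty)$ be an open set of pairs $(u,r)$ such that $(u,r)\in\Omega$ and $0<s\le r$ imply $(u,s)\in\Omega$, and let $\nu,\lambda,\rho,\phi$ be real functions of $(u,r)$ of class $C^2$ on $\Omega$. Let $g$ be a metric in the coordinates $(u,r,\theta,\varphi)$, $(u,r)\in\Omega$, $0<\theta<\pi$, whose scalar curvature $R$ takes its values in $I$, such that $\rho=\frac1\kappa\log f'(R)$ and such that the conformal metric has the Bondi form $$\tilde g=e^{\kappa\rho}g=-e^{2\nu}du^2-2e^{\nu+\lambda}\,du\,dr+r^2(d\theta^2+\sin^2\theta\,d\varphi^2).$$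 Let $R_{ab}$ be the Ricci tensor of $g$, $G_{ab}=R_{ab}-\frac R2g_{ab}$, and $$E_{ab}=f'(R)G_{ab}-\tfrac12\big(f(R)-Rf'(R)\big)g_{ab}+(g_{ab}\Box_g-\nabla_a\nabla_b)f'(R),$$ $$T_{ab}=\nabla_a\phi\nabla_b\phi-\big(\tfrac12\nabla^c\phi\nabla_c\phi+U(\phi)\big)g_{ab}.$$ The *full system* is $E_{ab}=8\pi T_{ab}$ together with the Klein–Gordon equation $\Box_g\phi=U'(\phi)$, on the whole chart. Let $$n=e^{-\nu}\partial_u-\tfrac12e^{-\lambda}\partial_r,\quad l=e^{-\lambda}\partial_r,\quad \zeta_1=r^{-1}\partial_\theta,\quad \zeta_2=(r\sin\theta)^{-1}\partial_\varphi,\quad D=e^\nu n=\partial_u-\tfrac12e^{\nu-\lambda}\partial_r .$$ The *essential equations*, on $\Omega$, are $$\partial_r(\nu+\lambda)=\tfrac34\kappa^2r(\partial_r\rho)^2+4\pi re^{-\kappa\rho}(\partial_r\phi)^2,\tag{1}$$ $$\partial_r(re^{\nu-\lambda})=\big(1-r^2e^{-2\kappa\rho}(V_\star(\rho)+8\pi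 U(\phi))\big)e^{\nu+\lambda},\tag{2}$$ $$D(\partial_r(r\phi))=\tfrac r2\partial_r(e^{\nu-\lambda})\partial_r\phi+\tfrac\kappa2r\big(D\rho\,\partial_r\phi+D\phi\,\partial_r\rho\big)-\tfrac r2e^{\nu+\lambda-\kappa\rho}U'(\phi),\tag{3}$$ $$\begin{aligned}D(\partial_r(r\rho))={}&\tfrac12e^{\nu+\lambda}\big(1-e^{-2\lambda}-r^2e^{-2\kappa\rho}(V_\star(\rho)+8\pi U(\phi))\big)\partial_r\rho\\&-\tfrac{8\pi r}{3\kappa}e^{-\kappa\rho}\partial_r\phi\,D\phi-\tfrac1\kappa re^{\nu+\lambda}\big(W_\star(\rho)-\tfrac{16\pi}3e^{-2\kappa\rho}U(\phi)\big).\end{aligned}\tag{4}$$ *Claim.* (a) At every point, the components $E(n,l)=8\pi T(n,l)$ and $E(l,l)=8\pi T(l,l)$ hold together if and only if (1) and (2) hold there; the Klein–Gordon equation is equivalent to (3); and, where (2) holds, the trace $\operatorname{tr}_gE=8\pi\operatorname{tr}_gT$ is equivalent to (4). (b) The scalar curvature of $g$, and hence $\rho=\frac1\kappa\log f'(R)$,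 is given by $$R=e^{\kappa\rho}\big(\tilde R+3\kappa\,\Box_{\tilde g}\rho+3\kappa^2e^{-\nu-\lambda}D\rho\,\partial_r\rho\big),$$ where $$\Box_{\tilde g}\rho=-\tfrac{2}{re^{\nu+\lambda}}\big(D(\partial_r(r\rho))-\tfrac r2\partial_r(e^{\nu-\lambda})\partial_r\rho\big),$$ $$\tilde R=2e^{-\nu-\lambda}\partial_u\partial_r(\nu+\lambda)-\tfrac4re^{-2\lambda}\partial_r(\nu-\lambda)-2e^{-2\lambda}\big(\partial_r^2\nu+\partial_r\nu\,\partial_r(\nu-\lambda)\big)+\tfrac2{r^2}(1-e^{-2\lambda}).$$ (c) If $E_{ab}=8\pi T_{ab}$ on the whole chart, then (1), (2) and (4) hold on $\Omega$, and (3) holds at every point where $d\phi\ne0$. The full system implies the essential equations (1)–(4) on $\Omega$. (d) Assume the regularity condition at the center: for every $u$ for which some $(u,r)$ lies in $\Omega$ (and all $\theta,\varphi$), $$\lim_{r\to0}r^2e^{-\kappa\rho}(E-8\pi T)(D,D)=0 .$$ If the essential equations (1)–(4) hold on $\Omega$, then the remaining components $E(n,n)=8\pi T(n,n)$ and $E(\zeta_a,\zeta_a)=8\pi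 T(\zeta_a,\zeta_a)$, $a=1,2$, hold everywhere. Consequently, under the regularity condition the full system is equivalent to the essential equations. -/

import Mathlib

open Set Filter Topology

noncomputable section

namespace FRBondi

/-! ### Tensor calculus in a coordinate chart of a four-dimensional spacetime -/

/-- A point of the chart, `x = (u, r, θ, ϕ)`. -/
abbrev Coord := Fin 4 → ℝ

/-- A field of bilinear forms, given by its covariant coordinate components. -/
abbrev TensorField := Coord → Matrix (Fin 4) (Fin 4) ℝ

/-- Partial derivative `∂_i F` at `x`. -/
def pd (i : Fin 4) (F : Coord → ℝ) (x : Coord) : ℝ :=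
  deriv (fun t => F (Function.update x i t)) (x i)

/-- Christoffel symbols `Γ^c_{ab}` of the Levi-Civita connection of `g`. -/
def christoffel (g : TensorField) (c a b : Fin 4) (x : Coord) : ℝ :=
  (1 / 2) * ∑ d, (g x)⁻¹ c d *
    (pd a (fun y => g y d b) x + pd b (fun y => g y d a) x - pd d (fun y => g y a b) x)

/-- Ricci curvature
`R_{ab} = ∂_c Γ^c_{ab} - ∂_b Γ^c_{ac} + Γ^c_{cd} Γ^d_{ab} - Γ^c_{bd} Γ^d_{ac}`. -/
def ricci (g : TensorField) : TensorField := fun x a b =>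
  (∑ c, (pd c (christoffel g c a b) x - pd b (christoffel g c a c) x)) +
    ∑ c, ∑ d, (christoffel g c c d x * christoffel g d a b x -
      christoffel g c b d x * christoffel g d a c x)

/-- Trace `g^{ab} S_{ab}`. -/
def gTrace (g S : TensorField) (x : Coord) : ℝ :=
  ∑ a, ∑ b, (g x)⁻¹ a b * S x a b

/-- Scalar curvature `R`. -/
def scalarCurvature (g : TensorField) : Coord → ℝ := gTrace g (ricci g)

/-- Einstein tensor `G_{ab} = R_{ab} - (R / 2) g_{ab}`. -/
def einstein (g : TensorField) : TensorField := fun x a b =>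
  ricci g x a b - scalarCurvature g x / 2 * g x a b

/-- Covariant Hessian `∇_a ∇_b w = ∂_a ∂_b w - Γ^c_{ab} ∂_c w`. -/
def hessian (g : TensorField) (w : Coord → ℝ) : TensorField := fun x a b =>
  pd a (pd b w) x - ∑ c, christoffel g c a b x * pd c w x

/-- Wave operator `□_g w = g^{ab} ∇_a ∇_b w`. -/
def box (g : TensorField) (w : Coord → ℝ) : Coord → ℝ := gTrace g (hessian g w)

/-- The function `f'(R)` on the chart, `R` being the scalar curvature of `g`. -/
def fPrimeR (f : ℝ → ℝ) (g : TensorField) : Coord → ℝ := fun x => deriv f (scalarCurvature g x)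

/-- The tensor of modified gravity
`E_{ab} = f'(R) G_{ab} - (1/2) (f(R) - R f'(R)) g_{ab} + (g_{ab} □_g - ∇_a ∇_b) f'(R)`. -/
def modGravity (f : ℝ → ℝ) (g : TensorField) : TensorField := fun x a b =>
  fPrimeR f g x * einstein g x a b
    - (1 / 2) * (f (scalarCurvature g x) - scalarCurvature g x * fPrimeR f g x) * g x a b
    + (g x a b * box g (fPrimeR f g) x - hessian g (fPrimeR f g) x a b)

/-- The stress-energy tensor of a scalar field with potential `U`,
`T_{ab} = ∂_a Φ ∂_b Φ - ((1/2) g^{cd} ∂_c Φ ∂_d Φ + U(Φ)) g_{ab}`. -/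
def stressEnergy (U : ℝ → ℝ) (g : TensorField) (Φ : Coord → ℝ) : TensorField := fun x a b =>
  pd a Φ x * pd b Φ x
    - ((1 / 2) * gTrace g (fun y c d => pd c Φ y * pd d Φ y) x + U (Φ x)) * g x a b

/-- The component `S(X, Y) = S_{ab} X^a Y^b`. -/
def comp (S : Matrix (Fin 4) (Fin 4) ℝ) (X Y : Fin 4 → ℝ) : ℝ :=
  ∑ a, ∑ b, S a b * X a * Y b

/-! ### Spherical symmetry and Bondi coordinates -/

/-- A spherically symmetric function, viewed as a function on the chart. -/
def lift (w : ℝ → ℝ → ℝ) : Coord → ℝ := fun x => w (x 0) (x 1)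

/-- The part of the chart lying over a set `Ω` of values of `(u, r)`. -/
def chart (Ω : Set (ℝ × ℝ)) : Set Coord :=
  {x | (x 0, x 1) ∈ Ω ∧ 0 < x 2 ∧ x 2 < Real.pi}

/-- The metric `-e^{2ν} du² - 2 e^{ν+lam} du dr + r² (dθ² + sin² θ dϕ²)`. -/
def bondiMetric (ν lam : ℝ → ℝ → ℝ) : TensorField := fun x =>
  !![-Real.exp (2 * ν (x 0) (x 1)), -Real.exp (ν (x 0) (x 1) + lam (x 0) (x 1)), 0, 0;
     -Real.exp (ν (x 0) (x 1) + lam (x 0) (x 1)), 0, 0, 0;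
     0, 0, (x 1) ^ 2, 0;
     0, 0, 0, (x 1) ^ 2 * Real.sin (x 2) ^ 2]

/-- `n = e^{-ν} ∂_u - (1/2) e^{-lam} ∂_r`. -/
def vecN (ν lam : ℝ → ℝ → ℝ) (x : Coord) : Fin 4 → ℝ :=
  ![Real.exp (-ν (x 0) (x 1)), -(1 / 2) * Real.exp (-lam (x 0) (x 1)), 0, 0]

/-- `l = e^{-lam} ∂_r`. -/
def vecL (lam : ℝ → ℝ → ℝ) (x : Coord) : Fin 4 → ℝ :=
  ![0, Real.exp (-lam (x 0) (x 1)), 0, 0]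

/-- `ζ₁ = r^{-1} ∂_θ`. -/
def vecZ₁ (x : Coord) : Fin 4 → ℝ := ![0, 0, (x 1)⁻¹, 0]

/-- `ζ₂ = (r sin θ)^{-1} ∂_ϕ`. -/
def vecZ₂ (x : Coord) : Fin 4 → ℝ := ![0, 0, 0, (x 1 * Real.sin (x 2))⁻¹]

/-- The vector field `D = e^ν n = ∂_u - (1/2) e^{ν-lam} ∂_r`. -/
def vecD (ν lam : ℝ → ℝ → ℝ) (x : Coord) : Fin 4 → ℝ :=
  ![1, -(1 / 2) * Real.exp (ν (x 0) (x 1) - lam (x 0) (x 1)), 0, 0]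

/-- `∂_u w` for a function of `(u, r)`. -/
def du (w : ℝ → ℝ → ℝ) (u r : ℝ) : ℝ := deriv (fun t => w t r) u

/-- `∂_r w` for a function of `(u, r)`. -/
def dr (w : ℝ → ℝ → ℝ) (u r : ℝ) : ℝ := deriv (fun t => w u t) r

/-- The light ray operator `D w = ∂_u w - (1/2) e^{ν-lam} ∂_r w`. -/
def lightD (ν lam w : ℝ → ℝ → ℝ) (u r : ℝ) : ℝ :=
  du w u r - (1 / 2) * Real.exp (ν u r - lam u r) * dr w u r

/-- The wave operator of the Bondi metric on spherically symmetric functions,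
`-(2 / (r e^{ν+lam})) (D (∂_r (r w)) - (r/2) ∂_r (e^{ν-lam}) ∂_r w)`. -/
def boxBondi (ν lam w : ℝ → ℝ → ℝ) (u r : ℝ) : ℝ :=
  -(2 / (r * Real.exp (ν u r + lam u r))) *
    (lightD ν lam (dr (fun u r => r * w u r)) u r
      - r / 2 * dr (fun u r => Real.exp (ν u r - lam u r)) u r * dr w u r)

/-- The scalar curvature of the Bondi metric, in terms of the derivatives of `ν` and `lam` up to
second order. -/
def scalarBondi (ν lam : ℝ → ℝ → ℝ) (u r : ℝ) : ℝ :=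
  2 / Real.exp (ν u r + lam u r) * du (dr (fun u r => ν u r + lam u r)) u r
    - 4 / (r * Real.exp (2 * lam u r)) * dr (fun u r => ν u r - lam u r) u r
    - 2 / Real.exp (2 * lam u r) *
        (dr (dr ν) u r + dr ν u r * dr (fun u r => ν u r - lam u r) u r)
    + 2 / r ^ 2 * (1 - Real.exp (-2 * lam u r))

/-! ### The potentials and the essential equations

The function `f` is considered on a set `I` of admissible values of the scalar curvature. -/

/-- The inverse of the function `R ↦ (1/κ) log f'(R)` on `I`. -/
def Rstar (κ : ℝ) (f : ℝ → ℝ) (I : Set ℝ) : ℝ → ℝ :=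
  Function.invFunOn (fun R => 1 / κ * Real.log (deriv f R)) I

/-- The first potential `W(s) = (2 f(Rstar(s)) - Rstar(s) e^{κ s}) / (6 e^{2 κ s})`. -/
def Wstar (κ : ℝ) (f : ℝ → ℝ) (I : Set ℝ) (s : ℝ) : ℝ :=
  (2 * f (Rstar κ f I s) - Rstar κ f I s * Real.exp (κ * s)) / (6 * Real.exp (2 * κ * s))

/-- The second potential `V(s) = (1/2) Rstar(s) f'(Rstar(s)) - (1/2) f(Rstar(s))`. -/
def Vstar (κ : ℝ) (f : ℝ → ℝ) (I : Set ℝ) (s : ℝ) : ℝ :=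
  1 / 2 * Rstar κ f I s * deriv f (Rstar κ f I s) - 1 / 2 * f (Rstar κ f I s)

/-- First radial equation. -/
def RadialSum (κ : ℝ) (ν lam ρ φ : ℝ → ℝ → ℝ) (u r : ℝ) : Prop :=
  dr (fun u r => ν u r + lam u r) u r =
    3 / 4 * κ ^ 2 * r * (dr ρ u r) ^ 2
      + 4 * Real.pi * r * Real.exp (-κ * ρ u r) * (dr φ u r) ^ 2

/-- Second radial equation. -/
def RadialDiff (κ : ℝ) (f U : ℝ → ℝ) (I : Set ℝ) (ν lam ρ φ : ℝ → ℝ → ℝ) (u r : ℝ) : Prop :=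
  dr (fun u r => r * Real.exp (ν u r - lam u r)) u r =
    (1 - r ^ 2 * Real.exp (-2 * κ * ρ u r) *
        (Vstar κ f I (ρ u r) + 8 * Real.pi * U (φ u r))) * Real.exp (ν u r + lam u r)

/-- Transport equation for the scalar field. -/
def TransportPhi (κ : ℝ) (U : ℝ → ℝ) (ν lam ρ φ : ℝ → ℝ → ℝ) (u r : ℝ) : Prop :=
  lightD ν lam (dr (fun u r => r * φ u r)) u r =
    r / 2 * dr (fun u r => Real.exp (ν u r - lam u r)) u r * dr φ u r
      + κ / 2 * r * (lightD ν lam ρ u r * dr φ u r + lightD ν lam φ u r * dr ρ u r)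
      - r / 2 * Real.exp (ν u r + lam u r - κ * ρ u r) * deriv U (φ u r)

/-- Transport equation for `ρ`. -/
def TransportRho (κ : ℝ) (f U : ℝ → ℝ) (I : Set ℝ) (ν lam ρ φ : ℝ → ℝ → ℝ) (u r : ℝ) : Prop :=
  lightD ν lam (dr (fun u r => r * ρ u r)) u r =
    Real.exp (ν u r + lam u r) / 2 *
        (1 - Real.exp (-2 * lam u r) - r ^ 2 * Real.exp (-2 * κ * ρ u r) *
          (Vstar κ f I (ρ u r) + 8 * Real.pi * U (φ u r))) * dr ρ u r
      - 8 * Real.pi * r / (3 * κ) * Real.exp (-κ * ρ u r) * dr φ u r * lightD ν lam φ u r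
      - 1 / κ * r * Real.exp (ν u r + lam u r) *
        (Wstar κ f I (ρ u r) - 16 / 3 * Real.pi * Real.exp (-2 * κ * ρ u r) * U (φ u r))

/-- The essential equations, on the region `Ω`. -/
def EssentialEquations (κ : ℝ) (f U : ℝ → ℝ) (I : Set ℝ) (Ω : Set (ℝ × ℝ))
    (ν lam ρ φ : ℝ → ℝ → ℝ) : Prop :=
  ∀ u r, (u, r) ∈ Ω →
    RadialSum κ ν lam ρ φ u r ∧ RadialDiff κ f U I ν lam ρ φ u r ∧
      TransportPhi κ U ν lam ρ φ u r ∧ TransportRho κ f U I ν lam ρ φ u r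

/-- The tensorial field equations `E_{ab} = 8π T_{ab}` at the point `x`. -/
def FieldEquationsAt (f U : ℝ → ℝ) (g : TensorField) (φ : ℝ → ℝ → ℝ) (x : Coord) : Prop :=
  ∀ a b, modGravity f g x a b = 8 * Real.pi * stressEnergy U g (lift φ) x a b

/-- The Klein-Gordon equation `□_g φ = U'(φ)` at the point `x`. -/
def KleinGordonAt (U : ℝ → ℝ) (g : TensorField) (φ : ℝ → ℝ → ℝ) (x : Coord) : Prop :=
  box g (lift φ) x = deriv U (lift φ x)

/-- One component `E(X, Y) = 8π T(X, Y)` of the field equations at the point `x`. -/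
def ComponentAt (f U : ℝ → ℝ) (g : TensorField) (φ : ℝ → ℝ → ℝ) (x : Coord)
    (X Y : Fin 4 → ℝ) : Prop :=
  comp (modGravity f g x) X Y = 8 * Real.pi * comp (stressEnergy U g (lift φ) x) X Y

/-- The trace `tr E = 8π tr T` of the field equations at the point `x`. -/
def TraceAt (f U : ℝ → ℝ) (g : TensorField) (φ : ℝ → ℝ → ℝ) (x : Coord) : Prop :=
  gTrace g (modGravity f g) x = 8 * Real.pi * gTrace g (stressEnergy U g (lift φ)) x

/-- Regularity at the center: `r² e^{-κρ} (E - 8πT)(D, D) → 0` as `r → 0`, for each `u`. -/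
def RegularAtCenter (κ : ℝ) (f U : ℝ → ℝ) (Ω : Set (ℝ × ℝ)) (ν lam ρ φ : ℝ → ℝ → ℝ)
    (g : TensorField) : Prop :=
  ∀ u, (∃ r, (u, r) ∈ Ω) → ∀ θ ∈ Ioo 0 Real.pi, ∀ ϕ : ℝ,
    Tendsto (fun r : ℝ => r ^ 2 * Real.exp (-κ * ρ u r) *
        (comp (modGravity f g ![u, r, θ, ϕ]) (vecD ν lam ![u, r, θ, ϕ]) (vecD ν lam ![u, r, θ, ϕ])
          - 8 * Real.pi * comp (stressEnergy U g (lift φ) ![u, r, θ, ϕ])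
              (vecD ν lam ![u, r, θ, ϕ]) (vecD ν lam ![u, r, θ, ϕ])))
      (𝓝[>] 0) (𝓝 0)

end FRBondi

end

/-! The physical metric `g = e^{-κρ} g̃` is again spherical, `-e^{2N} du² - 2 e^{N+L} du dr + e^{2S}
dΩ²`, with `N = ν - κρ/2`, `L = λ - κρ/2`, `S = log r - κρ/2`. Its Christoffel symbols, Ricci tensor
and Hessians are therefore computed once for general `N, L, S`, and no conformal transformation law
is needed. Moreover `f'(R) = e^{κρ}` and `R = R_⋆(ρ)`, so `f(R) = R e^{κρ} - 2V_⋆(ρ)` and the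
residual `X = E - 8πT` becomes `e^{κρ} Ric - ∇∇e^{κρ} - 8π dφ⊗dφ` plus a multiple of `g`
(`fieldResidual_eq`).

By spherical symmetry `X` has four independent components. In the null frame `D, ∂_r` they give:
`X(∂_r,∂_r)`, proportional to the residual of (1); `X(D,∂_r)`, proportional to that of (2); the
trace, which is (4) modulo (2) once `R` is replaced by `R_⋆(ρ)`; and `X(D,D)`, whose multiple
`lightRes = r² e^{-κρ} X(D,D)` contains only first derivatives.

The rest is the contracted Bianchi identity, in a form requiring only `C²` data. If (1) and (2) hold
on `Ω`, differentiating them expresses `∂_r lightRes` through `∂_uρ` times the residual of (4) and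
`∂_uφ` times the residual of (3) (`hasDerivAt_lightRes`). Under the essential equations `lightRes`
is thus constant on each ray `u = const`, and the regularity condition makes the constant zero.
Conversely, under the tensor equations the same identity gives `∂_uφ` times the residual of (3)
equal to zero, and the `r` component of Bianchi gives the same with `∂_rφ`
(`dr_mul_transportPhiRes`), hence (3) wherever `dφ ≠ 0`. Differentiating (2) uses `V_⋆' = (κ/2)
e^{κρ} R_⋆`, a Legendre transform identity valid even where `f''` vanishes (`hasDerivAt_Vstar`). -/

noncomputable section

namespace FRBondi

/-! ### Partial derivatives of functions of two variables -/

section TwoVariables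

variable {Ω : Set (ℝ × ℝ)} {w : ℝ → ℝ → ℝ} {u r : ℝ}

theorem hasDerivAt_fderiv_fst (h : DifferentiableAt ℝ (Function.uncurry w) (u, r)) :
    HasDerivAt (fun t => w t r) (fderiv ℝ (Function.uncurry w) (u, r) (1, 0)) u := by
  have h1 : HasDerivAt (fun t : ℝ => (t, r)) ((1 : ℝ), (0 : ℝ)) u :=
    (hasDerivAt_id u).prodMk (hasDerivAt_const u r)
  exact h.hasFDerivAt.comp_hasDerivAt u h1

theorem hasDerivAt_fderiv_snd (h : DifferentiableAt ℝ (Function.uncurry w) (u, r)) :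
    HasDerivAt (fun t => w u t) (fderiv ℝ (Function.uncurry w) (u, r) (0, 1)) r := by
  have h1 : HasDerivAt (fun t : ℝ => (u, t)) ((0 : ℝ), (1 : ℝ)) r :=
    (hasDerivAt_const r u).prodMk (hasDerivAt_id r)
  exact h.hasFDerivAt.comp_hasDerivAt r h1

theorem differentiableAt_of_contDiffOn {n : WithTop ℕ∞} (hn : n ≠ 0) (hΩ : IsOpen Ω)
    (hw : ContDiffOn ℝ n (Function.uncurry w) Ω) (hx : (u, r) ∈ Ω) :
    DifferentiableAt ℝ (Function.uncurry w) (u, r) :=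
  (hw.contDiffAt (hΩ.mem_nhds hx)).differentiableAt hn

/-- The smoothness exponent is left free because this is applied both to the `C²` coefficients and
to their first derivatives, which are only `C¹`. -/
theorem hasDerivAt_du {n : WithTop ℕ∞} (hn : n ≠ 0) (hΩ : IsOpen Ω)
    (hw : ContDiffOn ℝ n (Function.uncurry w) Ω) (hx : (u, r) ∈ Ω) :
    HasDerivAt (fun t => w t r) (du w u r) u :=
  (hasDerivAt_fderiv_fst (differentiableAt_of_contDiffOn hn hΩ hw hx)).differentiableAt.hasDerivAt

theorem hasDerivAt_dr {n : WithTop ℕ∞} (hn : n ≠ 0) (hΩ : IsOpen Ω)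
    (hw : ContDiffOn ℝ n (Function.uncurry w) Ω) (hx : (u, r) ∈ Ω) :
    HasDerivAt (fun t => w u t) (dr w u r) r :=
  (hasDerivAt_fderiv_snd (differentiableAt_of_contDiffOn hn hΩ hw hx)).differentiableAt.hasDerivAt

theorem contDiffOn_du (hΩ : IsOpen Ω) (hw : ContDiffOn ℝ 2 (Function.uncurry w) Ω) :
    ContDiffOn ℝ 1 (Function.uncurry (du w)) Ω := by
  have h1 : ContDiffOn ℝ 1 (fderiv ℝ (Function.uncurry w)) Ω :=
    hw.fderiv_of_isOpen hΩ (by norm_num)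
  refine (h1.clm_apply (contDiffOn_const (c := ((1 : ℝ), (0 : ℝ))))).congr ?_
  rintro ⟨u, r⟩ hx
  exact (hasDerivAt_fderiv_fst (differentiableAt_of_contDiffOn two_ne_zero hΩ hw hx)).deriv

theorem contDiffOn_dr (hΩ : IsOpen Ω) (hw : ContDiffOn ℝ 2 (Function.uncurry w) Ω) :
    ContDiffOn ℝ 1 (Function.uncurry (dr w)) Ω := by
  have h1 : ContDiffOn ℝ 1 (fderiv ℝ (Function.uncurry w)) Ω :=
    hw.fderiv_of_isOpen hΩ (by norm_num)
  refine (h1.clm_apply (contDiffOn_const (c := ((0 : ℝ), (1 : ℝ))))).congr ?_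
  rintro ⟨u, r⟩ hx
  exact (hasDerivAt_fderiv_snd (differentiableAt_of_contDiffOn two_ne_zero hΩ hw hx)).deriv

theorem eventually_mem_u (hΩ : IsOpen Ω) (hx : (u, r) ∈ Ω) : ∀ᶠ t in 𝓝 u, (t, r) ∈ Ω :=
  (Continuous.prodMk_left r).continuousAt.eventually_mem (hΩ.mem_nhds hx)

theorem eventually_mem_r (hΩ : IsOpen Ω) (hx : (u, r) ∈ Ω) : ∀ᶠ t in 𝓝 r, (u, t) ∈ Ω :=
  (Continuous.prodMk_right u).continuousAt.eventually_mem (hΩ.mem_nhds hx)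

/-- Mixed second derivatives commute. -/
theorem dr_du_eq_du_dr (hΩ : IsOpen Ω) (hw : ContDiffOn ℝ 2 (Function.uncurry w) Ω)
    (hx : (u, r) ∈ Ω) : dr (du w) u r = du (dr w) u r := by
  have h1 : DifferentiableAt ℝ (fderiv ℝ (Function.uncurry w)) (u, r) :=
    ((hw.fderiv_of_isOpen (m := 1) hΩ (by norm_num)).contDiffAt
      (hΩ.mem_nhds hx)).differentiableAt one_ne_zero
  -- Over `ℝ` the smoothness required for symmetry of the second derivative is exactly 2.
  have hsymm : IsSymmSndFDerivAt ℝ (Function.uncurry w) (u, r) :=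
    (hw.contDiffAt (hΩ.mem_nhds hx)).isSymmSndFDerivAt (by simp)
  have hu : HasDerivAt (fun t : ℝ => (t, r)) ((1 : ℝ), (0 : ℝ)) u :=
    (hasDerivAt_id u).prodMk (hasDerivAt_const u r)
  have hr : HasDerivAt (fun t : ℝ => (u, t)) ((0 : ℝ), (1 : ℝ)) r :=
    (hasDerivAt_const r u).prodMk (hasDerivAt_id r)
  have hv (v : ℝ × ℝ) : HasFDerivAt (fun p => fderiv ℝ (Function.uncurry w) p v)
      ((fderiv ℝ (fderiv ℝ (Function.uncurry w)) (u, r)).flip v) (u, r) :=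
    (ContinuousLinearMap.apply ℝ ℝ v).hasFDerivAt.comp (u, r) h1.hasFDerivAt
  have hA : HasDerivAt (fun t => fderiv ℝ (Function.uncurry w) (u, t) (1, 0))
      (fderiv ℝ (fderiv ℝ (Function.uncurry w)) (u, r) (0, 1) (1, 0)) r := by
    have h := hv (1, 0)
    exact h.comp_hasDerivAt r hr
  have hB : HasDerivAt (fun t => fderiv ℝ (Function.uncurry w) (t, r) (0, 1))
      (fderiv ℝ (fderiv ℝ (Function.uncurry w)) (u, r) (1, 0) (0, 1)) u := by
    have h := hv (0, 1)
    exact h.comp_hasDerivAt u hu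
  have hA' : dr (du w) u r = fderiv ℝ (fderiv ℝ (Function.uncurry w)) (u, r) (0, 1) (1, 0) := by
    refine (hA.congr_of_eventuallyEq ?_).deriv
    filter_upwards [eventually_mem_r hΩ hx] with t ht
    exact (hasDerivAt_fderiv_fst (differentiableAt_of_contDiffOn two_ne_zero hΩ hw ht)).deriv
  have hB' : du (dr w) u r = fderiv ℝ (fderiv ℝ (Function.uncurry w)) (u, r) (1, 0) (0, 1) := by
    refine (hB.congr_of_eventuallyEq ?_).deriv
    filter_upwards [eventually_mem_u hΩ hx] with t ht
    exact (hasDerivAt_fderiv_snd (differentiableAt_of_contDiffOn two_ne_zero hΩ hw ht)).deriv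
  rw [hA', hB', hsymm.eq]

/-- First derivatives have closed forms only on `Ω`; openness of `Ω` allows those forms to be
differentiated again. -/
theorem du_congr {v : ℝ → ℝ → ℝ} (hΩ : IsOpen Ω) (hx : (u, r) ∈ Ω)
    (h : ∀ u r, (u, r) ∈ Ω → v u r = w u r) : du v u r = du w u r := by
  refine Filter.EventuallyEq.deriv_eq ?_
  filter_upwards [eventually_mem_u hΩ hx] with t ht using h _ _ ht

theorem dr_congr {v : ℝ → ℝ → ℝ} (hΩ : IsOpen Ω) (hx : (u, r) ∈ Ω)
    (h : ∀ u r, (u, r) ∈ Ω → v u r = w u r) : dr v u r = dr w u r := by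
  refine Filter.EventuallyEq.deriv_eq ?_
  filter_upwards [eventually_mem_r hΩ hx] with t ht using h _ _ ht

end TwoVariables

/-! ### Locality of the curvature -/

theorem isOpen_chart {Ω : Set (ℝ × ℝ)} (hΩ : IsOpen Ω) : IsOpen (chart Ω) := by
  refine IsOpen.inter (hΩ.preimage (f := fun x : Coord => (x 0, x 1)) (by fun_prop))
    (IsOpen.inter ?_ ?_)
  · exact isOpen_lt continuous_const (continuous_apply 2)
  · exact isOpen_lt (continuous_apply 2) continuous_const

section Locality

variable {s : Set Coord} {g g' S S' : TensorField} {w w' : Coord → ℝ} {x : Coord}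

/-- Outside the chart `g` is arbitrary. Curvature at a point depends only on the germ of `g` there,
so on an open set the metric may be replaced by its explicit form before anything is differentiated.
-/
theorem pd_congr (hs : IsOpen s) (h : EqOn w w' s) (i : Fin 4) : EqOn (pd i w) (pd i w') s := by
  intro x hx
  refine Filter.EventuallyEq.deriv_eq ?_
  have hc : ContinuousAt (fun t => Function.update x i t) (x i) :=
    (continuous_const.update i continuous_id).continuousAt
  have := hc.eventually_mem (hs.mem_nhds (by simpa using hx))
  filter_upwards [this] with t ht using h ht

theorem christoffel_congr (hs : IsOpen s) (h : EqOn g g' s) (c a b : Fin 4) :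
    EqOn (christoffel g c a b) (christoffel g' c a b) s := by
  intro x hx
  have hpd : ∀ i a b : Fin 4, pd i (fun y => g y a b) x = pd i (fun y => g' y a b) x :=
    fun i a b => pd_congr hs (fun y hy => by simp only [h hy]) i hx
  simp only [christoffel, hpd, h hx]

theorem ricci_congr (hs : IsOpen s) (h : EqOn g g' s) : EqOn (ricci g) (ricci g') s := by
  intro x hx
  ext a b
  have hpd : ∀ i c a b : Fin 4, pd i (christoffel g c a b) x = pd i (christoffel g' c a b) x :=
    fun i c a b => pd_congr hs (christoffel_congr hs h c a b) i hx
  simp only [ricci, hpd, fun c a b => christoffel_congr hs h c a b hx]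

theorem gTrace_congr (h : EqOn g g' s) (hS : EqOn S S' s) :
    EqOn (gTrace g S) (gTrace g' S') s := by
  intro x hx
  simp only [gTrace, h hx, hS hx]

theorem scalarCurvature_congr (hs : IsOpen s) (h : EqOn g g' s) :
    EqOn (scalarCurvature g) (scalarCurvature g') s :=
  gTrace_congr h (ricci_congr hs h)

theorem hessian_congr (hs : IsOpen s) (h : EqOn g g' s) (hw : EqOn w w' s) :
    EqOn (hessian g w) (hessian g' w') s := by
  intro x hx
  ext a b
  simp only [hessian, pd_congr hs (pd_congr hs hw b) a hx, fun c => pd_congr hs hw c hx,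
    fun c a b => christoffel_congr hs h c a b hx]

theorem box_congr (hs : IsOpen s) (h : EqOn g g' s) (hw : EqOn w w' s) :
    EqOn (box g w) (box g' w') s :=
  gTrace_congr h (hessian_congr hs h hw)

end Locality

/-- The cases appear with the numerals `0, 1, 2, 3`, on which the component tables defined by
`match` reduce. -/
theorem forall_fin_four {P : Fin 4 → Prop} (h0 : P 0) (h1 : P 1) (h2 : P 2) (h3 : P 3)
    (i : Fin 4) : P i := by
  fin_cases i <;> assumption

/-! ### Functions with separated angular dependence -/

/-- The function `w(u, r) h(θ)` on the chart. -/
def sep (w : ℝ → ℝ → ℝ) (h : ℝ → ℝ) : Coord → ℝ := fun x => w (x 0) (x 1) * h (x 2)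

section Sep

variable (w : ℝ → ℝ → ℝ) (h : ℝ → ℝ) (x : Coord)

/-- No differentiability is required: a constant factor from a field commutes with `deriv` even when
`deriv` takes its default value. All metric components and Christoffel symbols below are of this
separated form or zero. -/
theorem pd_zero_sep : pd 0 (sep w h) x = du w (x 0) (x 1) * h (x 2) := by
  have : (fun t => sep w h (Function.update x 0 t)) = fun t => w t (x 1) * h (x 2) := by
    ext t; simp [sep]
  rw [pd, this, deriv_mul_const_field, du]

theorem pd_one_sep : pd 1 (sep w h) x = dr w (x 0) (x 1) * h (x 2) := by
  have : (fun t => sep w h (Function.update x 1 t)) = fun t => w (x 0) t * h (x 2) := by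
    ext t; simp [sep]
  rw [pd, this, deriv_mul_const_field, dr]

theorem pd_two_sep : pd 2 (sep w h) x = w (x 0) (x 1) * deriv h (x 2) := by
  have : (fun t => sep w h (Function.update x 2 t)) = fun t => w (x 0) (x 1) * h t := by
    ext t; simp [sep]
  rw [pd, this, deriv_const_mul_field]

theorem pd_three_sep : pd 3 (sep w h) x = 0 := by
  have : (fun t => sep w h (Function.update x 3 t)) = fun _ => sep w h x := by
    ext t; simp [sep]
  rw [pd, this, deriv_const]

theorem pd_zero_fun (i : Fin 4) : pd i 0 x = 0 := by
  simp [pd]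

theorem lift_eq_sep : lift w = sep w (fun _ => 1) := by
  ext x; simp [lift, sep]

end Sep

/-! ### Spherically symmetric metrics -/

/-- The components of the metric `-e^{2N} du² - 2 e^{N+L} du dr + e^{2S} (dθ² + sin² θ dϕ²)`. -/
def sphericalComponents (N L S : ℝ → ℝ → ℝ) : Fin 4 → Fin 4 → Coord → ℝ
  | 0, 0 => sep (fun u r => -Real.exp (N u r + N u r)) (fun _ => 1)
  | 0, 1 => sep (fun u r => -Real.exp (N u r + L u r)) (fun _ => 1)
  | 1, 0 => sep (fun u r => -Real.exp (N u r + L u r)) (fun _ => 1)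
  | 2, 2 => sep (fun u r => Real.exp (S u r + S u r)) (fun _ => 1)
  | 3, 3 => sep (fun u r => Real.exp (S u r + S u r)) (fun θ => Real.sin θ ^ 2)
  | _, _ => 0

/-- The metric `-e^{2N} du² - 2 e^{N+L} du dr + e^{2S} (dθ² + sin² θ dϕ²)`. -/
def sphericalMetric (N L S : ℝ → ℝ → ℝ) : TensorField :=
  fun x a b => sphericalComponents N L S a b x

/-- The components of the inverse of `sphericalMetric N L S`. -/
def sphericalInverse (N L S : ℝ → ℝ → ℝ) (x : Coord) : Fin 4 → Fin 4 → ℝ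
  | 0, 1 => -Real.exp (-N (x 0) (x 1) - L (x 0) (x 1))
  | 1, 0 => -Real.exp (-N (x 0) (x 1) - L (x 0) (x 1))
  | 1, 1 => Real.exp (-L (x 0) (x 1) - L (x 0) (x 1))
  | 2, 2 => Real.exp (-S (x 0) (x 1) - S (x 0) (x 1))
  | 3, 3 => Real.exp (-S (x 0) (x 1) - S (x 0) (x 1)) / Real.sin (x 2) ^ 2
  | _, _ => 0

theorem sphericalMetric_inv (N L S : ℝ → ℝ → ℝ) {x : Coord} (hx : Real.sin (x 2) ≠ 0)
    (c d : Fin 4) : (sphericalMetric N L S x)⁻¹ c d = sphericalInverse N L S x c d := by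
  have h : (sphericalMetric N L S x)⁻¹ = Matrix.of (sphericalInverse N L S x) := by
    refine Matrix.inv_eq_right_inv ?_
    have hN := Real.exp_ne_zero (N (x 0) (x 1))
    have hL := Real.exp_ne_zero (L (x 0) (x 1))
    have hS := Real.exp_ne_zero (S (x 0) (x 1))
    ext a b
    simp only [Matrix.mul_apply, Fin.sum_univ_four, Matrix.of_apply, sphericalMetric]
    revert a b
    refine forall_fin_four ?_ ?_ ?_ ?_ <;> refine forall_fin_four ?_ ?_ ?_ ?_ <;>
    simp [sphericalComponents, sphericalInverse, sep, Real.exp_add, Real.exp_sub, Real.exp_neg] <;>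
    field_simp <;> ring
  rw [h, Matrix.of_apply]

section Christoffel

variable {Ω : Set (ℝ × ℝ)} {N L S : ℝ → ℝ → ℝ}

/-- The partial derivatives `∂_i g_{ab}` of the components of `sphericalMetric N L S`. -/
def sphericalPartials (N L S : ℝ → ℝ → ℝ) (x : Coord) (i a b : Fin 4) : ℝ :=
  let u := x 0
  let r := x 1
  let P := Real.exp (N u r) * Real.exp (N u r)
  let Q := Real.exp (N u r) * Real.exp (L u r)
  let Y := Real.exp (S u r) * Real.exp (S u r)
  match i, a, b with
  | 0, 0, 0 => -(2 * P * du N u r)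
  | 0, 0, 1 => -(Q * (du N u r + du L u r))
  | 0, 1, 0 => -(Q * (du N u r + du L u r))
  | 0, 2, 2 => 2 * Y * du S u r
  | 0, 3, 3 => 2 * Y * du S u r * Real.sin (x 2) ^ 2
  | 1, 0, 0 => -(2 * P * dr N u r)
  | 1, 0, 1 => -(Q * (dr N u r + dr L u r))
  | 1, 1, 0 => -(Q * (dr N u r + dr L u r))
  | 1, 2, 2 => 2 * Y * dr S u r
  | 1, 3, 3 => 2 * Y * dr S u r * Real.sin (x 2) ^ 2
  | 2, 3, 3 => Y * (2 * Real.sin (x 2) * Real.cos (x 2))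
  | _, _, _ => 0

theorem pd_sphericalComponents (hΩ : IsOpen Ω)
    (hN : ContDiffOn ℝ 2 (Function.uncurry N) Ω) (hL : ContDiffOn ℝ 2 (Function.uncurry L) Ω)
    (hS : ContDiffOn ℝ 2 (Function.uncurry S) Ω) {x : Coord} (hx : x ∈ chart Ω) (i a b : Fin 4) :
    pd i (sphericalComponents N L S a b) x = sphericalPartials N L S x i a b := by
  obtain ⟨hxΩ, hθ⟩ := hx
  have huN := hasDerivAt_du two_ne_zero hΩ hN hxΩ
  have hrN := hasDerivAt_dr two_ne_zero hΩ hN hxΩ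
  have huL := hasDerivAt_du two_ne_zero hΩ hL hxΩ
  have hrL := hasDerivAt_dr two_ne_zero hΩ hL hxΩ
  have huS := hasDerivAt_du two_ne_zero hΩ hS hxΩ
  have hrS := hasDerivAt_dr two_ne_zero hΩ hS hxΩ
  have d1 : du (fun u r => -Real.exp (N u r + N u r)) (x 0) (x 1) =
    -(Real.exp (N (x 0) (x 1)) * Real.exp (N (x 0) (x 1)) * (du N (x 0) (x 1) + du N (x 0) (x 1))) := by
    rw [← Real.exp_add]
    exact (huN.add huN).exp.neg.deriv
  have d2 : dr (fun u r => -Real.exp (N u r + N u r)) (x 0) (x 1) =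
    -(Real.exp (N (x 0) (x 1)) * Real.exp (N (x 0) (x 1)) * (dr N (x 0) (x 1) + dr N (x 0) (x 1))) := by
    rw [← Real.exp_add]
    exact (hrN.add hrN).exp.neg.deriv
  have d3 : du (fun u r => -Real.exp (N u r + L u r)) (x 0) (x 1) =
    -(Real.exp (N (x 0) (x 1)) * Real.exp (L (x 0) (x 1)) * (du N (x 0) (x 1) + du L (x 0) (x 1))) := by
    rw [← Real.exp_add]
    exact (huN.add huL).exp.neg.deriv
  have d4 : dr (fun u r => -Real.exp (N u r + L u r)) (x 0) (x 1) =
    -(Real.exp (N (x 0) (x 1)) * Real.exp (L (x 0) (x 1)) * (dr N (x 0) (x 1) + dr L (x 0) (x 1))) := by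
    rw [← Real.exp_add]
    exact (hrN.add hrL).exp.neg.deriv
  have d5 : du (fun u r => Real.exp (S u r + S u r)) (x 0) (x 1) =
    Real.exp (S (x 0) (x 1)) * Real.exp (S (x 0) (x 1)) * (du S (x 0) (x 1) + du S (x 0) (x 1)) := by
    rw [← Real.exp_add]
    exact (huS.add huS).exp.deriv
  have d6 : dr (fun u r => Real.exp (S u r + S u r)) (x 0) (x 1) =
    Real.exp (S (x 0) (x 1)) * Real.exp (S (x 0) (x 1)) * (dr S (x 0) (x 1) + dr S (x 0) (x 1)) := by
    rw [← Real.exp_add]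
    exact (hrS.add hrS).exp.deriv
  have hY : Real.exp (S (x 0) (x 1) + S (x 0) (x 1)) =
      Real.exp (S (x 0) (x 1)) * Real.exp (S (x 0) (x 1)) := Real.exp_add _ _
  have hsq : deriv (fun θ => Real.sin θ ^ 2) (x 2) = 2 * Real.sin (x 2) * Real.cos (x 2) := by
    simp
  revert i a b
  refine forall_fin_four ?_ ?_ ?_ ?_ <;> refine forall_fin_four ?_ ?_ ?_ ?_ <;>
    refine forall_fin_four ?_ ?_ ?_ ?_ <;>
    simp only [sphericalComponents, sphericalPartials, pd_zero_sep, pd_one_sep, pd_two_sep,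
      pd_three_sep, pd_zero_fun, d1, d2, d3, d4, d5, d6, hsq, hY, deriv_const] <;>
    ring

/-- The Christoffel symbols of `sphericalMetric N L S`. -/
def sphericalChristoffel (N L S : ℝ → ℝ → ℝ) (c a b : Fin 4) : Coord → ℝ :=
  let one : ℝ → ℝ := fun _ => 1
  let s2 : ℝ → ℝ := fun θ => Real.sin θ ^ 2
  let A : ℝ → ℝ → ℝ := fun u r => dr S u r * Real.exp (S u r + S u r - N u r - L u r)
  let B : ℝ → ℝ → ℝ := fun u r => du S u r * Real.exp (S u r + S u r - N u r - L u r)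
    - dr S u r * Real.exp (S u r + S u r - L u r - L u r)
  let C : ℝ → ℝ → ℝ := fun u r => dr N u r * Real.exp (N u r - L u r)
  match c, a, b with
  | 0, 0, 0 => sep (fun u r => du N u r + du L u r - dr N u r * Real.exp (N u r - L u r)) one
  | 0, 2, 2 => sep A one
  | 0, 3, 3 => sep A s2
  | 1, 0, 0 => sep (fun u r => dr N u r * Real.exp (N u r + N u r - L u r - L u r)
      - du L u r * Real.exp (N u r - L u r)) one
  | 1, 0, 1 => sep C one
  | 1, 1, 0 => sep C one
  | 1, 1, 1 => sep (fun u r => dr N u r + dr L u r) one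
  | 1, 2, 2 => sep B one
  | 1, 3, 3 => sep B s2
  | 2, 0, 2 => sep (du S) one
  | 2, 2, 0 => sep (du S) one
  | 2, 1, 2 => sep (dr S) one
  | 2, 2, 1 => sep (dr S) one
  | 2, 3, 3 => sep (fun _ _ => 1) (fun θ => -(Real.sin θ * Real.cos θ))
  | 3, 0, 3 => sep (du S) one
  | 3, 3, 0 => sep (du S) one
  | 3, 1, 3 => sep (dr S) one
  | 3, 3, 1 => sep (dr S) one
  | 3, 2, 3 => sep (fun _ _ => 1) (fun θ => Real.cos θ / Real.sin θ)
  | 3, 3, 2 => sep (fun _ _ => 1) (fun θ => Real.cos θ / Real.sin θ)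
  | _, _, _ => 0

-- Once the exponentials are split into products of `e^N`, `e^L`, `e^S` and their inverses, each of
-- the 64 cases is a rational identity.
set_option maxHeartbeats 2000000 in
theorem christoffel_sphericalMetric (hΩ : IsOpen Ω)
    (hN : ContDiffOn ℝ 2 (Function.uncurry N) Ω) (hL : ContDiffOn ℝ 2 (Function.uncurry L) Ω)
    (hS : ContDiffOn ℝ 2 (Function.uncurry S) Ω) {x : Coord} (hx : x ∈ chart Ω) (c a b : Fin 4) :
    christoffel (sphericalMetric N L S) c a b x = sphericalChristoffel N L S c a b x := by
  have hsin : Real.sin (x 2) ≠ 0 := (Real.sin_pos_of_mem_Ioo hx.2).ne'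
  have hpd : ∀ i a b, pd i (fun y => sphericalMetric N L S y a b) x =
    sphericalPartials N L S x i a b := pd_sphericalComponents hΩ hN hL hS hx
  have hNe := Real.exp_ne_zero (N (x 0) (x 1))
  have hLe := Real.exp_ne_zero (L (x 0) (x 1))
  have hSe := Real.exp_ne_zero (S (x 0) (x 1))
  simp only [christoffel, sphericalMetric_inv N L S hsin, hpd, Fin.sum_univ_four]
  revert c a b
  refine forall_fin_four ?_ ?_ ?_ ?_ <;> refine forall_fin_four ?_ ?_ ?_ ?_ <;>
    refine forall_fin_four ?_ ?_ ?_ ?_ <;>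
    simp only [sphericalInverse, sphericalPartials, sphericalChristoffel, sep, Real.exp_add,
      Real.exp_sub, Real.exp_neg, Pi.zero_apply, mul_zero, zero_mul, add_zero, sub_zero,
      zero_sub, zero_add] <;>
    field_simp <;> ring

end Christoffel

/-! ### The Ricci tensor of a spherically symmetric metric -/

section Ricci

variable {Ω : Set (ℝ × ℝ)} {N L S : ℝ → ℝ → ℝ}

/-- The `ur` component of the Ricci tensor of the two-dimensional metric
`-e^{2N} du² - 2 e^{N+L} du dr`. -/
def ricciPlane (N L : ℝ → ℝ → ℝ) (u r : ℝ) : ℝ :=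
  -(du (dr N) u r + du (dr L) u r)
    + (dr (dr N) u r + dr N u r * (dr N u r - dr L u r)) * Real.exp (N u r - L u r)

/-- `e^{-S} ∇_u ∇_u e^S`, for the metric `-e^{2N} du² - 2 e^{N+L} du dr`. -/
def warpUU (N L S : ℝ → ℝ → ℝ) (u r : ℝ) : ℝ :=
  du (du S) u r + du S u r ^ 2
    - (du N u r + du L u r - dr N u r * Real.exp (N u r - L u r)) * du S u r
    - (dr N u r * Real.exp (N u r + N u r - L u r - L u r)
        - du L u r * Real.exp (N u r - L u r)) * dr S u r

/-- `e^{-S} ∇_u ∇_r e^S`, for the metric `-e^{2N} du² - 2 e^{N+L} du dr`. -/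
def warpUR (N L S : ℝ → ℝ → ℝ) (u r : ℝ) : ℝ :=
  du (dr S) u r + du S u r * dr S u r - dr N u r * Real.exp (N u r - L u r) * dr S u r

/-- `e^{-S} ∇_r ∇_r e^S`, for the metric `-e^{2N} du² - 2 e^{N+L} du dr`. -/
def warpRR (N L S : ℝ → ℝ → ℝ) (u r : ℝ) : ℝ :=
  dr (dr S) u r + dr S u r ^ 2 - (dr N u r + dr L u r) * dr S u r

/-- The `θθ` component of the Ricci tensor of `sphericalMetric N L S`. -/
def ricciSphere (N L S : ℝ → ℝ → ℝ) (u r : ℝ) : ℝ :=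
  1 - Real.exp (S u r + S u r) *
    (Real.exp (-L u r - L u r) * (warpRR N L S u r + dr S u r ^ 2)
      - 2 * Real.exp (-N u r - L u r) * (warpUR N L S u r + du S u r * dr S u r))

/-- The components of the Ricci tensor of `sphericalMetric N L S`. -/
def sphericalRicci (N L S : ℝ → ℝ → ℝ) (x : Coord) (a b : Fin 4) : ℝ :=
  let u := x 0
  let r := x 1
  match a, b with
  | 0, 0 => ricciPlane N L u r * Real.exp (N u r - L u r) - 2 * warpUU N L S u r
  | 0, 1 => ricciPlane N L u r - 2 * warpUR N L S u r
  | 1, 0 => ricciPlane N L u r - 2 * warpUR N L S u r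
  | 1, 1 => -2 * warpRR N L S u r
  | 2, 2 => ricciSphere N L S u r
  | 3, 3 => ricciSphere N L S u r * Real.sin (x 2) ^ 2
  | _, _ => 0

-- The closed form is that of a warped product of the `(u, r)` plane with the unit sphere, with
-- warping function `e^S`: on the plane `Ric = K g - 2 e^{-S} ∇∇e^S`, where 2 is the dimension of
-- the sphere. As the first term is proportional to the plane metric, its `uu` part is `e^{N-L}`
-- times its `ur` part. The verification is by direct expansion.
set_option maxHeartbeats 4000000 in
theorem ricci_sphericalMetric (hΩ : IsOpen Ω)
    (hN : ContDiffOn ℝ 2 (Function.uncurry N) Ω) (hL : ContDiffOn ℝ 2 (Function.uncurry L) Ω)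
    (hS : ContDiffOn ℝ 2 (Function.uncurry S) Ω) {x : Coord} (hx : x ∈ chart Ω) (a b : Fin 4) :
    ricci (sphericalMetric N L S) x a b = sphericalRicci N L S x a b := by
  have hsin : Real.sin (x 2) ≠ 0 := (Real.sin_pos_of_mem_Ioo hx.2).ne'
  have hΓ := fun (y : Coord) (hy : y ∈ chart Ω) c a b =>
    christoffel_sphericalMetric hΩ hN hL hS hy c a b
  have hpd : ∀ i c a b, pd i (christoffel (sphericalMetric N L S) c a b) x =
      pd i (sphericalChristoffel N L S c a b) x :=
    fun i c a b => pd_congr (isOpen_chart hΩ) (fun y hy => hΓ y hy c a b) i hx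
  have hxΩ := hx.1
  have huN := hasDerivAt_du two_ne_zero hΩ hN hxΩ
  have hrN := hasDerivAt_dr two_ne_zero hΩ hN hxΩ
  have huL := hasDerivAt_du two_ne_zero hΩ hL hxΩ
  have hrL := hasDerivAt_dr two_ne_zero hΩ hL hxΩ
  have huS := hasDerivAt_du two_ne_zero hΩ hS hxΩ
  have hrS := hasDerivAt_dr two_ne_zero hΩ hS hxΩ
  have huuN := hasDerivAt_du one_ne_zero hΩ (contDiffOn_du hΩ hN) hxΩ
  have hruN := hasDerivAt_dr one_ne_zero hΩ (contDiffOn_du hΩ hN) hxΩ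
  have hurN := hasDerivAt_du one_ne_zero hΩ (contDiffOn_dr hΩ hN) hxΩ
  have hrrN := hasDerivAt_dr one_ne_zero hΩ (contDiffOn_dr hΩ hN) hxΩ
  have huuL := hasDerivAt_du one_ne_zero hΩ (contDiffOn_du hΩ hL) hxΩ
  have hruL := hasDerivAt_dr one_ne_zero hΩ (contDiffOn_du hΩ hL) hxΩ
  have hurL := hasDerivAt_du one_ne_zero hΩ (contDiffOn_dr hΩ hL) hxΩ
  have hrrL := hasDerivAt_dr one_ne_zero hΩ (contDiffOn_dr hΩ hL) hxΩ
  have hruS := hasDerivAt_dr one_ne_zero hΩ (contDiffOn_du hΩ hS) hxΩ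
  have hurS := hasDerivAt_du one_ne_zero hΩ (contDiffOn_dr hΩ hS) hxΩ
  have hrrS := hasDerivAt_dr one_ne_zero hΩ (contDiffOn_dr hΩ hS) hxΩ
  -- Mixed derivatives are all brought to the order `∂_u ∂_r`, so that `ring` sees a single symbol
  -- for each.
  rw [dr_du_eq_du_dr hΩ hN hxΩ] at hruN
  rw [dr_du_eq_du_dr hΩ hL hxΩ] at hruL
  rw [dr_du_eq_du_dr hΩ hS hxΩ] at hruS
  have d1 := ((huuN.add huuL).sub (hurN.mul (huN.sub huL).exp)).deriv
  have d2 := ((hruN.add hruL).sub (hrrN.mul (hrN.sub hrL).exp)).deriv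
  have d3 := (hurS.mul (((huS.add huS).sub huN).sub huL).exp).deriv
  have d4 := ((hruS.mul (((hrS.add hrS).sub hrN).sub hrL).exp).sub
    (hrrS.mul (((hrS.add hrS).sub hrL).sub hrL).exp)).deriv
  have d5 := ((hrrN.mul (((hrN.add hrN).sub hrL).sub hrL).exp).sub
    (hruL.mul (hrN.sub hrL).exp)).deriv
  have d6 := (hurN.mul (huN.sub huL).exp).deriv
  have d7 := (hrrN.mul (hrN.sub hrL).exp).deriv
  have d8 := (hurN.add hurL).deriv
  have d9 := (hrrN.add hrrL).deriv
  -- The derivatives above concern pointwise combinations of functions; these definitionally equal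
  -- restatements match the coefficients in `sphericalChristoffel` syntactically and can serve as
  -- rewriting rules.
  have e1 : du (fun u r => du N u r + du L u r - dr N u r * Real.exp (N u r - L u r)) (x 0) (x 1)
    = _ := d1
  have e2 : dr (fun u r => du N u r + du L u r - dr N u r * Real.exp (N u r - L u r)) (x 0) (x 1)
    = _ := d2
  have e3 : du (fun u r => dr S u r * Real.exp (S u r + S u r - N u r - L u r)) (x 0) (x 1)
    = _ := d3
  have e4 : dr (fun u r => du S u r * Real.exp (S u r + S u r - N u r - L u r)
    - dr S u r * Real.exp (S u r + S u r - L u r - L u r)) (x 0) (x 1) = _ := d4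
  have e5 : dr (fun u r => dr N u r * Real.exp (N u r + N u r - L u r - L u r)
      - du L u r * Real.exp (N u r - L u r)) (x 0) (x 1) = _ := d5
  have e6 : du (fun u r => dr N u r * Real.exp (N u r - L u r)) (x 0) (x 1) = _ := d6
  have e7 : dr (fun u r => dr N u r * Real.exp (N u r - L u r)) (x 0) (x 1) = _ := d7
  have e8 : du (fun u r => dr N u r + dr L u r) (x 0) (x 1) = _ := d8
  have e9 : dr (fun u r => dr N u r + dr L u r) (x 0) (x 1) = _ := d9
  have t1 : deriv (fun θ => -(Real.sin θ * Real.cos θ)) (x 2) =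
      Real.sin (x 2) ^ 2 - Real.cos (x 2) ^ 2 := by
    refine ((Real.hasDerivAt_sin (x 2)).mul (Real.hasDerivAt_cos (x 2))).neg.deriv.trans ?_
    ring
  -- The form `-(1 + cot²)`, rather than `-1/sin²`, makes the `θθ` component close without the
  -- identity `sin² + cos² = 1`.
  have t2 : deriv (fun θ => Real.cos θ / Real.sin θ) (x 2) =
      -(1 + (Real.cos (x 2) / Real.sin (x 2)) ^ 2) := by
    refine ((Real.hasDerivAt_cos (x 2)).div (Real.hasDerivAt_sin (x 2)) hsin).deriv.trans ?_
    field_simp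
    ring
  have c1 : du (fun _ _ => (1 : ℝ)) (x 0) (x 1) = 0 := deriv_const _ _
  have c2 : dr (fun _ _ => (1 : ℝ)) (x 0) (x 1) = 0 := deriv_const _ _
  have hNe := Real.exp_ne_zero (N (x 0) (x 1))
  have hLe := Real.exp_ne_zero (L (x 0) (x 1))
  have hSe := Real.exp_ne_zero (S (x 0) (x 1))
  clear d1 d2 d3 d4 d5 d6 d7 d8 d9
  simp only [Pi.add_apply, Pi.sub_apply] at e1 e2 e3 e4 e5 e6 e7 e8 e9
  simp only [ricci, hpd, hΓ x hx, Fin.sum_univ_four]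
  clear hpd hΓ
  revert a b
  refine forall_fin_four ?_ ?_ ?_ ?_ <;> refine forall_fin_four ?_ ?_ ?_ ?_ <;>
    simp only [sphericalChristoffel, pd_zero_sep, pd_one_sep, pd_two_sep, pd_three_sep,
      pd_zero_fun, sphericalRicci, e1, e2, e3, e4, e5, e6, e7, e8, e9, t1, t2, c1, c2, deriv_const,
      dr_du_eq_du_dr hΩ hS hxΩ] <;>
    simp only [ricciPlane, ricciSphere, warpUU, warpUR, warpRR, sep, Real.exp_add,
      Real.exp_sub, Real.exp_neg, Pi.zero_apply, mul_zero, zero_mul, add_zero, sub_zero,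
      zero_sub, zero_add, mul_one] <;>
    field_simp <;> ring

end Ricci

/-! ### Traces and Hessians for a spherically symmetric metric -/

section Hessian

variable {Ω : Set (ℝ × ℝ)} {N L S w : ℝ → ℝ → ℝ}

theorem gTrace_sphericalMetric {x : Coord} (hx : x ∈ chart Ω) (T : TensorField) :
    gTrace (sphericalMetric N L S) T x =
      -Real.exp (-N (x 0) (x 1) - L (x 0) (x 1)) * (T x 0 1 + T x 1 0)
        + Real.exp (-L (x 0) (x 1) - L (x 0) (x 1)) * T x 1 1
        + Real.exp (-S (x 0) (x 1) - S (x 0) (x 1)) * (T x 2 2 + T x 3 3 / Real.sin (x 2) ^ 2) := by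
  have hsin : Real.sin (x 2) ≠ 0 := (Real.sin_pos_of_mem_Ioo hx.2).ne'
  simp only [gTrace, sphericalMetric_inv N L S hsin, Fin.sum_univ_four, sphericalInverse]
  ring

theorem scalarCurvature_sphericalMetric (hΩ : IsOpen Ω)
    (hN : ContDiffOn ℝ 2 (Function.uncurry N) Ω) (hL : ContDiffOn ℝ 2 (Function.uncurry L) Ω)
    (hS : ContDiffOn ℝ 2 (Function.uncurry S) Ω) {x : Coord} (hx : x ∈ chart Ω) :
    scalarCurvature (sphericalMetric N L S) x =
      -2 * Real.exp (-N (x 0) (x 1) - L (x 0) (x 1)) *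
          (ricciPlane N L (x 0) (x 1) - 2 * warpUR N L S (x 0) (x 1))
        - 2 * Real.exp (-L (x 0) (x 1) - L (x 0) (x 1)) * warpRR N L S (x 0) (x 1)
        + 2 * Real.exp (-S (x 0) (x 1) - S (x 0) (x 1)) * ricciSphere N L S (x 0) (x 1) := by
  have hsin : Real.sin (x 2) ≠ 0 := (Real.sin_pos_of_mem_Ioo hx.2).ne'
  rw [scalarCurvature, gTrace_sphericalMetric hx]
  simp only [ricci_sphericalMetric hΩ hN hL hS hx, sphericalRicci]
  field_simp
  ring

/-- The components of the Hessian of a function of `(u, r)` with respect to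
`sphericalMetric N L S`. -/
def sphericalHessian (N L S w : ℝ → ℝ → ℝ) (x : Coord) (a b : Fin 4) : ℝ :=
  let u := x 0
  let r := x 1
  let H := -(dr S u r * Real.exp (S u r + S u r - N u r - L u r) * du w u r)
    - (du S u r * Real.exp (S u r + S u r - N u r - L u r)
      - dr S u r * Real.exp (S u r + S u r - L u r - L u r)) * dr w u r
  match a, b with
  | 0, 0 => du (du w) u r
      - (du N u r + du L u r - dr N u r * Real.exp (N u r - L u r)) * du w u r
      - (dr N u r * Real.exp (N u r + N u r - L u r - L u r)
        - du L u r * Real.exp (N u r - L u r)) * dr w u r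
  | 0, 1 => du (dr w) u r - dr N u r * Real.exp (N u r - L u r) * dr w u r
  | 1, 0 => du (dr w) u r - dr N u r * Real.exp (N u r - L u r) * dr w u r
  | 1, 1 => dr (dr w) u r - (dr N u r + dr L u r) * dr w u r
  | 2, 2 => H
  | 3, 3 => H * Real.sin (x 2) ^ 2
  | _, _ => 0

/-- An equality of functions, free of smoothness hypotheses, so that it can be rewritten under the
second derivative in the Hessian. -/
theorem pd_lift (i : Fin 4) (w : ℝ → ℝ → ℝ) :
    pd i (lift w) = match i with
      | 0 => lift (du w)
      | 1 => lift (dr w)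
      | _ => 0 := by
  ext x
  rw [lift_eq_sep]
  revert i
  refine forall_fin_four ?_ ?_ ?_ ?_ <;>
    simp only [pd_zero_sep, pd_one_sep, pd_two_sep, pd_three_sep, deriv_const, lift, mul_one,
      mul_zero, Pi.zero_apply]

theorem pd_zero_lift : pd 0 (lift w) = lift (du w) := pd_lift 0 w

theorem pd_one_lift : pd 1 (lift w) = lift (dr w) := pd_lift 1 w

theorem pd_two_lift : pd 2 (lift w) = 0 := pd_lift 2 w

theorem pd_three_lift : pd 3 (lift w) = 0 := pd_lift 3 w

theorem hessian_sphericalMetric (hΩ : IsOpen Ω)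
    (hN : ContDiffOn ℝ 2 (Function.uncurry N) Ω) (hL : ContDiffOn ℝ 2 (Function.uncurry L) Ω)
    (hS : ContDiffOn ℝ 2 (Function.uncurry S) Ω) (hw : ContDiffOn ℝ 2 (Function.uncurry w) Ω)
    {x : Coord} (hx : x ∈ chart Ω) (a b : Fin 4) :
    hessian (sphericalMetric N L S) (lift w) x a b = sphericalHessian N L S w x a b := by
  have hsymm := dr_du_eq_du_dr hΩ hw hx.1
  simp only [hessian, christoffel_sphericalMetric hΩ hN hL hS hx, Fin.sum_univ_four]
  revert a b
  refine forall_fin_four ?_ ?_ ?_ ?_ <;> refine forall_fin_four ?_ ?_ ?_ ?_ <;>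
    simp only [sphericalChristoffel, sphericalHessian, pd_zero_lift, pd_one_lift, pd_two_lift,
      pd_three_lift, pd_zero_fun, sep, lift, hsymm, Pi.zero_apply] <;>
    ring

theorem box_sphericalMetric (hΩ : IsOpen Ω)
    (hN : ContDiffOn ℝ 2 (Function.uncurry N) Ω) (hL : ContDiffOn ℝ 2 (Function.uncurry L) Ω)
    (hS : ContDiffOn ℝ 2 (Function.uncurry S) Ω) (hw : ContDiffOn ℝ 2 (Function.uncurry w) Ω)
    {x : Coord} (hx : x ∈ chart Ω) :
    box (sphericalMetric N L S) (lift w) x =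
      -2 * Real.exp (-N (x 0) (x 1) - L (x 0) (x 1)) * sphericalHessian N L S w x 0 1
        + Real.exp (-L (x 0) (x 1) - L (x 0) (x 1)) * sphericalHessian N L S w x 1 1
        + 2 * Real.exp (-S (x 0) (x 1) - S (x 0) (x 1)) * sphericalHessian N L S w x 2 2 := by
  have hsin : Real.sin (x 2) ≠ 0 := (Real.sin_pos_of_mem_Ioo hx.2).ne'
  rw [box, gTrace_sphericalMetric hx]
  simp only [hessian_sphericalMetric hΩ hN hL hS hw hx, sphericalHessian]
  field_simp
  ring

theorem gTrace_gradient_sphericalMetric {x : Coord} (hx : x ∈ chart Ω) :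
    gTrace (sphericalMetric N L S) (fun y c d => pd c (lift w) y * pd d (lift w) y) x =
      -2 * Real.exp (-N (x 0) (x 1) - L (x 0) (x 1)) * (du w (x 0) (x 1) * dr w (x 0) (x 1))
        + Real.exp (-L (x 0) (x 1) - L (x 0) (x 1)) * dr w (x 0) (x 1) ^ 2 := by
  refine (gTrace_sphericalMetric hx _).trans ?_
  simp only [pd_zero_lift, pd_one_lift, pd_two_lift, pd_three_lift, lift, Pi.zero_apply]
  ring

end Hessian

/-! ### The physical metric in Bondi coordinates -/

/-- The logarithmic metric coefficient `v - κρ/2`, which `v` becomes under the conformal change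
from `e^{κρ} g` to `g`. -/
def conf (κ : ℝ) (v ρ : ℝ → ℝ → ℝ) : ℝ → ℝ → ℝ := fun u r => v u r - κ / 2 * ρ u r

section Conf

variable {κ : ℝ} {Ω : Set (ℝ × ℝ)} {v ρ : ℝ → ℝ → ℝ} {u r : ℝ}

theorem contDiffOn_conf (hv : ContDiffOn ℝ 2 (Function.uncurry v) Ω)
    (hρ : ContDiffOn ℝ 2 (Function.uncurry ρ) Ω) :
    ContDiffOn ℝ 2 (Function.uncurry (conf κ v ρ)) Ω :=
  hv.sub (contDiffOn_const.mul hρ)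

theorem conf_derivs (hΩ : IsOpen Ω) (hv : ContDiffOn ℝ 2 (Function.uncurry v) Ω)
    (hρ : ContDiffOn ℝ 2 (Function.uncurry ρ) Ω) (hx : (u, r) ∈ Ω) :
    du (conf κ v ρ) u r = du v u r - κ / 2 * du ρ u r ∧
    dr (conf κ v ρ) u r = dr v u r - κ / 2 * dr ρ u r ∧
    du (du (conf κ v ρ)) u r = du (du v) u r - κ / 2 * du (du ρ) u r ∧
    du (dr (conf κ v ρ)) u r = du (dr v) u r - κ / 2 * du (dr ρ) u r ∧
    dr (dr (conf κ v ρ)) u r = dr (dr v) u r - κ / 2 * dr (dr ρ) u r := by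
  have h1 : ∀ u r, (u, r) ∈ Ω → du (conf κ v ρ) u r = du v u r - κ / 2 * du ρ u r :=
    fun u r hx => ((hasDerivAt_du two_ne_zero hΩ hv hx).sub
      ((hasDerivAt_du two_ne_zero hΩ hρ hx).const_mul (κ / 2))).deriv
  have h2 : ∀ u r, (u, r) ∈ Ω → dr (conf κ v ρ) u r = dr v u r - κ / 2 * dr ρ u r :=
    fun u r hx => ((hasDerivAt_dr two_ne_zero hΩ hv hx).sub
      ((hasDerivAt_dr two_ne_zero hΩ hρ hx).const_mul (κ / 2))).deriv
  refine ⟨h1 u r hx, h2 u r hx, ?_, ?_, ?_⟩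
  · refine (du_congr hΩ hx h1).trans ?_
    exact ((hasDerivAt_du one_ne_zero hΩ (contDiffOn_du hΩ hv) hx).sub
      ((hasDerivAt_du one_ne_zero hΩ (contDiffOn_du hΩ hρ) hx).const_mul (κ / 2))).deriv
  · refine (du_congr hΩ hx h2).trans ?_
    exact ((hasDerivAt_du one_ne_zero hΩ (contDiffOn_dr hΩ hv) hx).sub
      ((hasDerivAt_du one_ne_zero hΩ (contDiffOn_dr hΩ hρ) hx).const_mul (κ / 2))).deriv
  · refine (dr_congr hΩ hx h2).trans ?_
    exact ((hasDerivAt_dr one_ne_zero hΩ (contDiffOn_dr hΩ hv) hx).sub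
      ((hasDerivAt_dr one_ne_zero hΩ (contDiffOn_dr hΩ hρ) hx).const_mul (κ / 2))).deriv

/-- The function `e^{κρ}`. -/
def expMul (κ : ℝ) (ρ : ℝ → ℝ → ℝ) : ℝ → ℝ → ℝ := fun u r => Real.exp (κ * ρ u r)

theorem contDiffOn_expMul (hρ : ContDiffOn ℝ 2 (Function.uncurry ρ) Ω) :
    ContDiffOn ℝ 2 (Function.uncurry (expMul κ ρ)) Ω :=
  (contDiffOn_const.mul hρ).exp

theorem expMul_derivs (hΩ : IsOpen Ω) (hρ : ContDiffOn ℝ 2 (Function.uncurry ρ) Ω)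
    (hx : (u, r) ∈ Ω) :
    du (expMul κ ρ) u r = κ * du ρ u r * Real.exp (κ * ρ u r) ∧
    dr (expMul κ ρ) u r = κ * dr ρ u r * Real.exp (κ * ρ u r) ∧
    du (du (expMul κ ρ)) u r =
      (κ * du (du ρ) u r + κ ^ 2 * du ρ u r ^ 2) * Real.exp (κ * ρ u r) ∧
    du (dr (expMul κ ρ)) u r =
      (κ * du (dr ρ) u r + κ ^ 2 * du ρ u r * dr ρ u r) * Real.exp (κ * ρ u r) ∧
    dr (dr (expMul κ ρ)) u r =
      (κ * dr (dr ρ) u r + κ ^ 2 * dr ρ u r ^ 2) * Real.exp (κ * ρ u r) := by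
  have e1 := fun {u r} (hx : (u, r) ∈ Ω) => ((hasDerivAt_du two_ne_zero hΩ hρ hx).const_mul κ).exp
  have e2 := fun {u r} (hx : (u, r) ∈ Ω) => ((hasDerivAt_dr two_ne_zero hΩ hρ hx).const_mul κ).exp
  have h1 : ∀ u r, (u, r) ∈ Ω →
      du (expMul κ ρ) u r = κ * du ρ u r * Real.exp (κ * ρ u r) :=
    fun u r hx => (e1 hx).deriv.trans (mul_comm _ _)
  have h2 : ∀ u r, (u, r) ∈ Ω →
      dr (expMul κ ρ) u r = κ * dr ρ u r * Real.exp (κ * ρ u r) :=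
    fun u r hx => (e2 hx).deriv.trans (mul_comm _ _)
  refine ⟨h1 u r hx, h2 u r hx, ?_, ?_, ?_⟩
  · refine (du_congr hΩ hx h1).trans ?_
    refine (((hasDerivAt_du one_ne_zero hΩ (contDiffOn_du hΩ hρ) hx).const_mul κ).mul
      (e1 hx)).deriv.trans ?_
    ring
  · refine (du_congr hΩ hx h2).trans ?_
    refine (((hasDerivAt_du one_ne_zero hΩ (contDiffOn_dr hΩ hρ) hx).const_mul κ).mul
      (e1 hx)).deriv.trans ?_
    ring
  · refine (dr_congr hΩ hx h2).trans ?_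
    refine (((hasDerivAt_dr one_ne_zero hΩ (contDiffOn_dr hΩ hρ) hx).const_mul κ).mul
      (e2 hx)).deriv.trans ?_
    ring

/-- The logarithm of the area radius. -/
def logRadius : ℝ → ℝ → ℝ := fun _ r => Real.log r

theorem contDiffOn_logRadius (hpos : ∀ u r, (u, r) ∈ Ω → 0 < r) :
    ContDiffOn ℝ 2 (Function.uncurry logRadius) Ω :=
  contDiffOn_snd.log (fun p hp => (hpos p.1 p.2 hp).ne')

theorem logRadius_derivs (hΩ : IsOpen Ω)
    (hx : (u, r) ∈ Ω) :
    du logRadius u r = 0 ∧ dr logRadius u r = r⁻¹ ∧ du (du logRadius) u r = 0 ∧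
      du (dr logRadius) u r = 0 ∧ dr (dr logRadius) u r = -(r ^ 2)⁻¹ := by
  have h1 : ∀ u r, (u, r) ∈ Ω → du logRadius u r = 0 := fun u r _ => deriv_const _ _
  have h2 : ∀ u r, (u, r) ∈ Ω → dr logRadius u r = r⁻¹ := fun u r _ => Real.deriv_log r
  refine ⟨h1 u r hx, h2 u r hx, ?_, ?_, ?_⟩
  · exact (du_congr (w := fun _ _ => 0) hΩ hx h1).trans (deriv_const _ _)
  · exact (du_congr (w := fun _ r => r⁻¹) hΩ hx h2).trans (deriv_const _ _)
  · exact (dr_congr (w := fun _ r => r⁻¹) hΩ hx h2).trans (deriv_inv)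

end Conf

/-- A spherically symmetric metric `g` on the chart over `Ω`, with `e^{κρ} g` in Bondi form, where
`κρ` is the logarithm of `f'(R)`. -/
structure BondiFrame (κ : ℝ) (I : Set ℝ) (f : ℝ → ℝ) (Ω : Set (ℝ × ℝ))
    (ν lam ρ φ : ℝ → ℝ → ℝ) (g : TensorField) : Prop where
  pos : 0 < κ
  deriv_pos : ∀ R ∈ I, 0 < deriv f R
  deriv_inj : Set.InjOn (deriv f) I
  isOpen : IsOpen Ω
  radius_pos : ∀ u r, (u, r) ∈ Ω → 0 < r
  smooth_ν : ContDiffOn ℝ 2 (Function.uncurry ν) Ω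
  smooth_lam : ContDiffOn ℝ 2 (Function.uncurry lam) Ω
  smooth_ρ : ContDiffOn ℝ 2 (Function.uncurry ρ) Ω
  smooth_φ : ContDiffOn ℝ 2 (Function.uncurry φ) Ω
  metric : ∀ x ∈ chart Ω, Real.exp (κ * lift ρ x) • g x = bondiMetric ν lam x
  scalar_mem : ∀ x ∈ chart Ω, scalarCurvature g x ∈ I
  ρ_eq : ∀ x ∈ chart Ω, lift ρ x = 1 / κ * Real.log (deriv f (scalarCurvature g x))

/-- The metric `e^{-κρ} (-e^{2ν} du² - 2 e^{ν+lam} du dr + r² (dθ² + sin² θ dϕ²))`. -/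
def physMetric (κ : ℝ) (ν lam ρ : ℝ → ℝ → ℝ) : TensorField :=
  sphericalMetric (conf κ ν ρ) (conf κ lam ρ) (conf κ logRadius ρ)

/-- The exponentials of multiples of `κ s` in terms of the square root of `e^{κ s}`. -/
theorem exp_kappa (κ s : ℝ) :
    Real.exp (κ * s) = Real.exp (κ / 2 * s) ^ 2 ∧
    Real.exp (-κ * s) = (Real.exp (κ / 2 * s) ^ 2)⁻¹ ∧
    Real.exp (2 * κ * s) = Real.exp (κ / 2 * s) ^ 4 ∧
    Real.exp (-2 * κ * s) = (Real.exp (κ / 2 * s) ^ 4)⁻¹ := by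
  simp only [← Real.exp_nat_mul, ← Real.exp_neg]
  refine ⟨?_, ?_, ?_, ?_⟩ <;> congr 1 <;> push_cast <;> ring

theorem exp_two_mul (s : ℝ) : Real.exp (2 * s) = Real.exp s ^ 2 := by
  rw [← Real.exp_nat_mul]; norm_num

theorem exp_neg_two_mul (s : ℝ) : Real.exp (-2 * s) = (Real.exp s ^ 2)⁻¹ := by
  rw [← Real.exp_nat_mul, ← Real.exp_neg]; congr 1; push_cast; ring

/-- `invFunOn` is a genuine inverse only at attained values of an injective function. Injectivity of
`f'` passes to `(1/κ) log f'` because `log` is injective on the positive reals. -/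
theorem Rstar_of_deriv_eq {κ : ℝ} {I : Set ℝ} {f : ℝ → ℝ} (hκ : κ ≠ 0) (hpos : ∀ R ∈ I, 0 < deriv f R)
    (hinj : Set.InjOn (deriv f) I) {R s : ℝ} (hR : R ∈ I) (hs : deriv f R = Real.exp (κ * s)) :
    Rstar κ f I s = R := by
  have hinj' : Set.InjOn (fun R => 1 / κ * Real.log (deriv f R)) I := by
    intro a ha b hb hab
    have h1 : Real.log (deriv f a) = Real.log (deriv f b) :=
      mul_left_cancel₀ (one_div_ne_zero hκ) hab
    exact hinj ha hb (Real.log_injOn_pos (hpos a ha) (hpos b hb) h1)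
  have h1 : s = 1 / κ * Real.log (deriv f R) := by
    rw [hs, Real.log_exp]; field_simp
  rw [Rstar, h1]
  exact hinj'.leftInvOn_invFunOn hR

/-! ### Identification of `g`, `f'(R)`, `R` and `f(R)` in terms of `ν`, `lam`, `ρ` -/

namespace BondiFrame

variable {κ : ℝ} {I : Set ℝ} {f : ℝ → ℝ} {Ω : Set (ℝ × ℝ)} {ν lam ρ φ : ℝ → ℝ → ℝ}
  {g : TensorField}

/-- Dividing the Bondi form by `e^{κρ}` subtracts `κρ/2` from each logarithmic coefficient,
including the logarithm of the area radius. -/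
theorem g_eq (h : BondiFrame κ I f Ω ν lam ρ φ g) : EqOn g (physMetric κ ν lam ρ) (chart Ω) := by
  intro x hx
  have hr := h.radius_pos _ _ hx.1
  have h1 := h.metric x hx
  have hh := Real.exp_ne_zero (κ / 2 * ρ (x 0) (x 1))
  ext a b
  have h2 : Real.exp (κ * lift ρ x) * g x a b = bondiMetric ν lam x a b := by rw [← h1]; rfl
  have h3 : g x a b = (Real.exp (κ / 2 * ρ (x 0) (x 1)) ^ 2)⁻¹ * bondiMetric ν lam x a b := by
    rw [← h2, lift, (exp_kappa κ (ρ (x 0) (x 1))).1]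
    field_simp
  rw [h3]
  simp only [physMetric, sphericalMetric]
  clear h2 h3
  revert a b
  refine forall_fin_four ?_ ?_ ?_ ?_ <;> refine forall_fin_four ?_ ?_ ?_ ?_ <;>
    simp [bondiMetric, sphericalComponents, sep, conf, logRadius, Real.exp_add, Real.exp_sub,
      Real.exp_log hr, exp_two_mul] <;>
    field_simp

/-- This is what makes the Hessian of `f'(R)` accessible: `R` contains second derivatives of `C²`
functions, but `e^{κρ}` is `C²`. -/
theorem fPrimeR_eq (h : BondiFrame κ I f Ω ν lam ρ φ g) :
    EqOn (fPrimeR f g) (lift (expMul κ ρ)) (chart Ω) := by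
  intro x hx
  have h1 := h.ρ_eq x hx
  change deriv f (scalarCurvature g x) = Real.exp (κ * lift ρ x)
  rw [h1, ← mul_assoc, mul_one_div_cancel h.pos.ne', one_mul,
    Real.exp_log (h.deriv_pos _ (h.scalar_mem x hx))]

theorem Rstar_eq (h : BondiFrame κ I f Ω ν lam ρ φ g) {x : Coord} (hx : x ∈ chart Ω) :
    Rstar κ f I (ρ (x 0) (x 1)) = scalarCurvature g x :=
  Rstar_of_deriv_eq h.pos.ne' h.deriv_pos h.deriv_inj (h.scalar_mem x hx) (h.fPrimeR_eq hx)

/-- The definition of `V_⋆` read backwards, with `R_⋆(ρ) = R`; it eliminates `f` from the field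
equations. -/
theorem f_scalar_eq (h : BondiFrame κ I f Ω ν lam ρ φ g) {x : Coord} (hx : x ∈ chart Ω) :
    f (scalarCurvature g x) = scalarCurvature g x * Real.exp (κ * ρ (x 0) (x 1))
      - 2 * Vstar κ f I (ρ (x 0) (x 1)) := by
  have h1 : deriv f (scalarCurvature g x) = Real.exp (κ * ρ (x 0) (x 1)) := h.fPrimeR_eq hx
  rw [Vstar, h.Rstar_eq hx, h1]
  ring

end BondiFrame

/-- The residual `E_{ab} - 8π T_{ab}` of the tensorial field equations. -/
def fieldResidual (f U : ℝ → ℝ) (g : TensorField) (φ : ℝ → ℝ → ℝ) : TensorField := fun x a b =>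
  modGravity f g x a b - 8 * Real.pi * stressEnergy U g (lift φ) x a b

/-! ### The residual, the wave operator and the scalar curvature of the physical metric -/

namespace BondiFrame

variable {κ : ℝ} {I : Set ℝ} {f : ℝ → ℝ} {Ω : Set (ℝ × ℝ)} {ν lam ρ φ : ℝ → ℝ → ℝ}
  {g : TensorField}

/-- The coefficient of `g_{ab}` in `E_{ab} - 8π T_{ab}`. -/
def metricCoeff (κ : ℝ) (I : Set ℝ) (f U : ℝ → ℝ) (ν lam ρ φ : ℝ → ℝ → ℝ) (x : Coord) : ℝ :=
  box (physMetric κ ν lam ρ) (lift (expMul κ ρ)) x + Vstar κ f I (ρ (x 0) (x 1))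
    - scalarCurvature (physMetric κ ν lam ρ) x * Real.exp (κ * ρ (x 0) (x 1)) / 2
    + 8 * Real.pi * (1 / 2 *
      gTrace (physMetric κ ν lam ρ) (fun y c d => pd c (lift φ) y * pd d (lift φ) y) x
        + U (φ (x 0) (x 1)))

/-- Since `f' G - (f - R f') g / 2 = f' Ric - f g / 2`, everything other than the Ricci term, the
Hessian and `dφ⊗dφ` is a multiple of `g`. Those multiples are collected in one coefficient because
it drops out on null vectors. -/
theorem fieldResidual_eq (h : BondiFrame κ I f Ω ν lam ρ φ g) (U : ℝ → ℝ) {x : Coord}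
    (hx : x ∈ chart Ω) (a b : Fin 4) :
    fieldResidual f U g φ x a b =
      Real.exp (κ * ρ (x 0) (x 1)) *
          sphericalRicci (conf κ ν ρ) (conf κ lam ρ) (conf κ logRadius ρ) x a b
        + metricCoeff κ I f U ν lam ρ φ x *
          sphericalComponents (conf κ ν ρ) (conf κ lam ρ) (conf κ logRadius ρ) a b x
        - sphericalHessian (conf κ ν ρ) (conf κ lam ρ) (conf κ logRadius ρ) (expMul κ ρ) x a b
        - 8 * Real.pi * (pd a (lift φ) x * pd b (lift φ) x) := by
  have ho := isOpen_chart h.isOpen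
  have hS := contDiffOn_logRadius h.radius_pos
  have hf := h.f_scalar_eq hx
  have hF : fPrimeR f g x = Real.exp (κ * ρ (x 0) (x 1)) := h.fPrimeR_eq hx
  have hH := hessian_sphericalMetric h.isOpen (contDiffOn_conf (κ := κ) h.smooth_ν h.smooth_ρ)
    (contDiffOn_conf (κ := κ) h.smooth_lam h.smooth_ρ) (contDiffOn_conf (κ := κ) hS h.smooth_ρ)
    (contDiffOn_expMul (κ := κ) h.smooth_ρ) hx a b
  have hRic := ricci_sphericalMetric h.isOpen (contDiffOn_conf (κ := κ) h.smooth_ν h.smooth_ρ)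
    (contDiffOn_conf (κ := κ) h.smooth_lam h.smooth_ρ) (contDiffOn_conf (κ := κ) hS h.smooth_ρ)
    hx a b
  have hg : g x a b =
      sphericalComponents (conf κ ν ρ) (conf κ lam ρ) (conf κ logRadius ρ) a b x := by
    rw [h.g_eq hx]; rfl
  have hH' := congrFun (congrFun (hessian_congr ho h.g_eq h.fPrimeR_eq hx) a) b
  have hRic' := congrFun (congrFun (ricci_congr ho h.g_eq hx) a) b
  have hgr := gTrace_congr (s := chart Ω) h.g_eq
    (fun y _ => (rfl : (fun c d => pd c (lift φ) y * pd d (lift φ) y) = _)) hx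
  have hb := box_congr ho h.g_eq h.fPrimeR_eq hx
  have hR := scalarCurvature_congr ho h.g_eq hx
  rw [← hH, ← hRic, ← hg, metricCoeff]
  simp only [fieldResidual, modGravity, stressEnergy, einstein, hf, hF]
  rw [hb, hH', hRic', hR, hgr]
  simp only [physMetric, lift]
  ring

/-- Stated for general `w`, as it serves both `φ` in the Klein–Gordon equation and `e^{κρ}` in `E`.
The last bracket is the conformal correction in `□_g w = e^{κρ} (□_g̃ w - κ g̃(∇ρ, ∇w))`. -/
theorem box_phys (h : BondiFrame κ I f Ω ν lam ρ φ g) {w : ℝ → ℝ → ℝ}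
    (hw : ContDiffOn ℝ 2 (Function.uncurry w) Ω) {x : Coord} (hx : x ∈ chart Ω) :
    box (physMetric κ ν lam ρ) (lift w) x =
      -(2 * Real.exp (κ * ρ (x 0) (x 1)) / (x 1 * Real.exp (ν (x 0) (x 1) + lam (x 0) (x 1)))) *
        (x 1 * du (dr w) (x 0) (x 1) + du w (x 0) (x 1)
          - 1 / 2 * Real.exp (ν (x 0) (x 1) - lam (x 0) (x 1)) *
            (2 * dr w (x 0) (x 1) + x 1 * dr (dr w) (x 0) (x 1))
          - x 1 / 2 * Real.exp (ν (x 0) (x 1) - lam (x 0) (x 1)) *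
            (dr ν (x 0) (x 1) - dr lam (x 0) (x 1)) * dr w (x 0) (x 1)
          - κ / 2 * x 1 * (du ρ (x 0) (x 1) * dr w (x 0) (x 1) + du w (x 0) (x 1) * dr ρ (x 0) (x 1)
            - Real.exp (ν (x 0) (x 1) - lam (x 0) (x 1)) * dr ρ (x 0) (x 1) * dr w (x 0) (x 1))) := by
  have hr := h.radius_pos _ _ hx.1
  have hS := contDiffOn_logRadius h.radius_pos
  obtain ⟨n1, n2, n3, n4, n5⟩ := conf_derivs (κ := κ) h.isOpen h.smooth_ν h.smooth_ρ hx.1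
  obtain ⟨l1, l2, l3, l4, l5⟩ := conf_derivs (κ := κ) h.isOpen h.smooth_lam h.smooth_ρ hx.1
  obtain ⟨s1, s2, s3, s4, s5⟩ := conf_derivs (κ := κ) h.isOpen hS h.smooth_ρ hx.1
  obtain ⟨q1, q2, q3, q4, q5⟩ := logRadius_derivs h.isOpen hx.1
  have hp := Real.exp_ne_zero (ν (x 0) (x 1))
  have hq := Real.exp_ne_zero (lam (x 0) (x 1))
  have hh := Real.exp_ne_zero (κ / 2 * ρ (x 0) (x 1))
  rw [physMetric, box_sphericalMetric h.isOpen (contDiffOn_conf h.smooth_ν h.smooth_ρ)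
    (contDiffOn_conf h.smooth_lam h.smooth_ρ) (contDiffOn_conf hS h.smooth_ρ) hw hx]
  simp only [sphericalHessian, n2, l2, s1, s2, q1, q2]
  simp only [conf, logRadius, Real.exp_sub, Real.exp_add, Real.exp_log hr, neg_sub,
    (exp_kappa κ (ρ (x 0) (x 1))).1]
  field_simp
  ring

/-- This agrees with the four-dimensional conformal law `R = e^{κρ} (R̃ + 3κ □_g̃ ρ - (3/2) κ²
g̃(∇ρ, ∇ρ))`, because `g̃(∇ρ, ∇ρ) = -2 e^{-ν-lam} Dρ ∂_rρ`. -/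
theorem scalarCurvature_eq (h : BondiFrame κ I f Ω ν lam ρ φ g) {x : Coord} (hx : x ∈ chart Ω) :
    scalarCurvature (physMetric κ ν lam ρ) x = Real.exp (κ * ρ (x 0) (x 1)) *
        (2 / Real.exp (ν (x 0) (x 1) + lam (x 0) (x 1)) *
            (du (dr ν) (x 0) (x 1) + du (dr lam) (x 0) (x 1))
          - 4 / (x 1 * Real.exp (2 * lam (x 0) (x 1))) * (dr ν (x 0) (x 1) - dr lam (x 0) (x 1))
          - 2 / Real.exp (2 * lam (x 0) (x 1)) * (dr (dr ν) (x 0) (x 1)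
            + dr ν (x 0) (x 1) * (dr ν (x 0) (x 1) - dr lam (x 0) (x 1)))
          + 2 / x 1 ^ 2 * (1 - Real.exp (-2 * lam (x 0) (x 1)))
          + 3 * κ * (-(2 / (x 1 * Real.exp (ν (x 0) (x 1) + lam (x 0) (x 1)))) *
            (x 1 * du (dr ρ) (x 0) (x 1) + du ρ (x 0) (x 1)
              - 1 / 2 * Real.exp (ν (x 0) (x 1) - lam (x 0) (x 1)) *
                (2 * dr ρ (x 0) (x 1) + x 1 * dr (dr ρ) (x 0) (x 1))
              - x 1 / 2 * Real.exp (ν (x 0) (x 1) - lam (x 0) (x 1)) *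
                (dr ν (x 0) (x 1) - dr lam (x 0) (x 1)) * dr ρ (x 0) (x 1)))
          + 3 * κ ^ 2 * Real.exp (-ν (x 0) (x 1) - lam (x 0) (x 1)) *
            (du ρ (x 0) (x 1)
              - 1 / 2 * Real.exp (ν (x 0) (x 1) - lam (x 0) (x 1)) * dr ρ (x 0) (x 1)) *
            dr ρ (x 0) (x 1)) := by
  have hr := h.radius_pos _ _ hx.1
  have hS := contDiffOn_logRadius h.radius_pos
  obtain ⟨n1, n2, n3, n4, n5⟩ := conf_derivs (κ := κ) h.isOpen h.smooth_ν h.smooth_ρ hx.1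
  obtain ⟨l1, l2, l3, l4, l5⟩ := conf_derivs (κ := κ) h.isOpen h.smooth_lam h.smooth_ρ hx.1
  obtain ⟨s1, s2, s3, s4, s5⟩ := conf_derivs (κ := κ) h.isOpen hS h.smooth_ρ hx.1
  obtain ⟨q1, q2, q3, q4, q5⟩ := logRadius_derivs h.isOpen hx.1
  have hp := Real.exp_ne_zero (ν (x 0) (x 1))
  have hq := Real.exp_ne_zero (lam (x 0) (x 1))
  have hh := Real.exp_ne_zero (κ / 2 * ρ (x 0) (x 1))
  rw [physMetric, scalarCurvature_sphericalMetric h.isOpen (contDiffOn_conf h.smooth_ν h.smooth_ρ)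
    (contDiffOn_conf h.smooth_lam h.smooth_ρ) (contDiffOn_conf hS h.smooth_ρ) hx]
  simp only [ricciPlane, ricciSphere, warpUR, warpRR, n2, n4, n5, l2, l4, s1, s2, s4,
    s5, q1, q2, q4, q5]
  simp only [conf, logRadius, Real.exp_sub, Real.exp_add, Real.exp_neg, Real.exp_log hr, neg_sub,
    (exp_kappa κ (ρ (x 0) (x 1))).1, exp_two_mul, exp_neg_two_mul]
  field_simp
  ring

end BondiFrame

/-! ### The essential equations in terms of derivatives of `ν`, `lam`, `ρ`, `φ` -/

section Residuals

variable (κ : ℝ) (f U : ℝ → ℝ) (I : Set ℝ) (ν lam ρ φ : ℝ → ℝ → ℝ) (u r : ℝ)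

/-- Left minus right hand side of `RadialSum`. -/
def radialSumRes : ℝ :=
  dr ν u r + dr lam u r - (3 / 4 * κ ^ 2 * r * (dr ρ u r) ^ 2
    + 4 * Real.pi * r * Real.exp (-κ * ρ u r) * (dr φ u r) ^ 2)

/-- Left minus right hand side of `RadialDiff`. -/
def radialDiffRes : ℝ :=
  Real.exp (ν u r - lam u r) + r * (Real.exp (ν u r - lam u r) * (dr ν u r - dr lam u r))
    - (1 - r ^ 2 * Real.exp (-2 * κ * ρ u r) *
        (Vstar κ f I (ρ u r) + 8 * Real.pi * U (φ u r))) * Real.exp (ν u r + lam u r)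

/-- The expansion of `D (∂_r (r w))`. -/
def transport (w : ℝ → ℝ → ℝ) : ℝ :=
  r * du (dr w) u r + du w u r
    - 1 / 2 * Real.exp (ν u r - lam u r) * (2 * dr w u r + r * dr (dr w) u r)

/-- Left minus right hand side of `TransportPhi`. -/
def transportPhiRes : ℝ :=
  transport ν lam u r φ
    - (r / 2 * (Real.exp (ν u r - lam u r) * (dr ν u r - dr lam u r)) * dr φ u r
      + κ / 2 * r * (lightD ν lam ρ u r * dr φ u r + lightD ν lam φ u r * dr ρ u r)
      - r / 2 * Real.exp (ν u r + lam u r - κ * ρ u r) * deriv U (φ u r))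

/-- Left minus right hand side of `TransportRho`. -/
def transportRhoRes : ℝ :=
  transport ν lam u r ρ
    - (Real.exp (ν u r + lam u r) / 2 *
        (1 - Real.exp (-2 * lam u r) - r ^ 2 * Real.exp (-2 * κ * ρ u r) *
          (Vstar κ f I (ρ u r) + 8 * Real.pi * U (φ u r))) * dr ρ u r
      - 8 * Real.pi * r / (3 * κ) * Real.exp (-κ * ρ u r) * dr φ u r * lightD ν lam φ u r
      - 1 / κ * r * Real.exp (ν u r + lam u r) *
        (Wstar κ f I (ρ u r) - 16 / 3 * Real.pi * Real.exp (-2 * κ * ρ u r) * U (φ u r)))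

/-- `r² e^{-κρ}` times the component `(E - 8π T)(D, D)`. -/
def lightRes : ℝ :=
  r * (Real.exp (ν u r - lam u r) * (Real.exp (ν u r - lam u r) / 2 * (dr ν u r + dr lam u r)
      - 2 * du lam u r))
    - r ^ 2 * (3 / 2 * κ ^ 2 * lightD ν lam ρ u r ^ 2
      + 8 * Real.pi * Real.exp (-κ * ρ u r) * lightD ν lam φ u r ^ 2)

end Residuals

theorem lightD_dr_mul {Ω : Set (ℝ × ℝ)} {ν lam w : ℝ → ℝ → ℝ} {u r : ℝ} (hΩ : IsOpen Ω)
    (hw : ContDiffOn ℝ 2 (Function.uncurry w) Ω) (hx : (u, r) ∈ Ω) :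
    lightD ν lam (dr (fun u r => r * w u r)) u r = transport ν lam u r w := by
  have h1 : ∀ u r, (u, r) ∈ Ω → dr (fun u r => r * w u r) u r = w u r + r * dr w u r := by
    intro u r hx
    refine ((hasDerivAt_id r).mul (hasDerivAt_dr two_ne_zero hΩ hw hx)).deriv.trans ?_
    simp
  have h2 : du (dr (fun u r => r * w u r)) u r = du w u r + r * du (dr w) u r := by
    refine (du_congr hΩ hx h1).trans ?_
    exact ((hasDerivAt_du two_ne_zero hΩ hw hx).add
      ((hasDerivAt_du one_ne_zero hΩ (contDiffOn_dr hΩ hw) hx).const_mul r)).deriv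
  have h3 : dr (dr (fun u r => r * w u r)) u r = 2 * dr w u r + r * dr (dr w) u r := by
    refine (dr_congr hΩ hx h1).trans ?_
    refine ((hasDerivAt_dr two_ne_zero hΩ hw hx).add
      ((hasDerivAt_id r).mul (hasDerivAt_dr one_ne_zero hΩ (contDiffOn_dr hΩ hw) hx))).deriv.trans ?_
    simp only [id_eq]
    ring
  rw [lightD, h2, h3, transport]
  ring

namespace BondiFrame

variable {κ : ℝ} {I : Set ℝ} {f : ℝ → ℝ} {Ω : Set (ℝ × ℝ)} {ν lam ρ φ : ℝ → ℝ → ℝ}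
  {g : TensorField} {u r : ℝ}

theorem dr_add (h : BondiFrame κ I f Ω ν lam ρ φ g) (hx : (u, r) ∈ Ω) :
    dr (fun u r => ν u r + lam u r) u r = dr ν u r + dr lam u r :=
  ((hasDerivAt_dr two_ne_zero h.isOpen h.smooth_ν hx).add
    (hasDerivAt_dr two_ne_zero h.isOpen h.smooth_lam hx)).deriv

theorem dr_sub (h : BondiFrame κ I f Ω ν lam ρ φ g) (hx : (u, r) ∈ Ω) :
    dr (fun u r => ν u r - lam u r) u r = dr ν u r - dr lam u r :=
  ((hasDerivAt_dr two_ne_zero h.isOpen h.smooth_ν hx).sub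
    (hasDerivAt_dr two_ne_zero h.isOpen h.smooth_lam hx)).deriv

theorem dr_exp_sub (h : BondiFrame κ I f Ω ν lam ρ φ g) (hx : (u, r) ∈ Ω) :
    dr (fun u r => Real.exp (ν u r - lam u r)) u r =
      Real.exp (ν u r - lam u r) * (dr ν u r - dr lam u r) :=
  ((hasDerivAt_dr two_ne_zero h.isOpen h.smooth_ν hx).sub
    (hasDerivAt_dr two_ne_zero h.isOpen h.smooth_lam hx)).exp.deriv

theorem dr_mul_exp_sub (h : BondiFrame κ I f Ω ν lam ρ φ g) (hx : (u, r) ∈ Ω) :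
    dr (fun u r => r * Real.exp (ν u r - lam u r)) u r =
      Real.exp (ν u r - lam u r)
        + r * (Real.exp (ν u r - lam u r) * (dr ν u r - dr lam u r)) := by
  refine ((hasDerivAt_id r).mul ((hasDerivAt_dr two_ne_zero h.isOpen h.smooth_ν hx).sub
    (hasDerivAt_dr two_ne_zero h.isOpen h.smooth_lam hx)).exp).deriv.trans ?_
  simp

theorem radialSum_iff (h : BondiFrame κ I f Ω ν lam ρ φ g) (hx : (u, r) ∈ Ω) :
    RadialSum κ ν lam ρ φ u r ↔ radialSumRes κ ν lam ρ φ u r = 0 := by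
  rw [RadialSum, radialSumRes, sub_eq_zero, h.dr_add hx]

theorem radialDiff_iff (h : BondiFrame κ I f Ω ν lam ρ φ g) (U : ℝ → ℝ) (hx : (u, r) ∈ Ω) :
    RadialDiff κ f U I ν lam ρ φ u r ↔ radialDiffRes κ f U I ν lam ρ φ u r = 0 := by
  rw [RadialDiff, radialDiffRes, sub_eq_zero, h.dr_mul_exp_sub hx]

theorem transportPhi_iff (h : BondiFrame κ I f Ω ν lam ρ φ g) (U : ℝ → ℝ) (hx : (u, r) ∈ Ω) :
    TransportPhi κ U ν lam ρ φ u r ↔ transportPhiRes κ U ν lam ρ φ u r = 0 := by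
  rw [TransportPhi, transportPhiRes, sub_eq_zero, h.dr_exp_sub hx,
    lightD_dr_mul h.isOpen h.smooth_φ hx]

theorem transportRho_iff (h : BondiFrame κ I f Ω ν lam ρ φ g) (U : ℝ → ℝ) (hx : (u, r) ∈ Ω) :
    TransportRho κ f U I ν lam ρ φ u r ↔ transportRhoRes κ f U I ν lam ρ φ u r = 0 := by
  rw [TransportRho, transportRhoRes, sub_eq_zero, lightD_dr_mul h.isOpen h.smooth_ρ hx]

/-! ### Components of the field equations -/

variable {x : Coord}

theorem box_sub_eq (h : BondiFrame κ I f Ω ν lam ρ φ g) (U : ℝ → ℝ) (hx : x ∈ chart Ω) :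
    box g (lift φ) x - deriv U (lift φ x) =
      -(2 * Real.exp (κ * ρ (x 0) (x 1)) / (x 1 * Real.exp (ν (x 0) (x 1) + lam (x 0) (x 1)))) *
        transportPhiRes κ U ν lam ρ φ (x 0) (x 1) := by
  have hr := h.radius_pos _ _ hx.1
  have hp := Real.exp_ne_zero (ν (x 0) (x 1))
  have hq := Real.exp_ne_zero (lam (x 0) (x 1))
  have hh := Real.exp_ne_zero (κ * ρ (x 0) (x 1))
  rw [box_congr (isOpen_chart h.isOpen) h.g_eq (fun y _ => rfl) hx, h.box_phys h.smooth_φ hx]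
  simp only [transportPhiRes, transport, lightD, lift, Real.exp_sub, Real.exp_add]
  field_simp
  ring

theorem scalarCurvature_bondi (h : BondiFrame κ I f Ω ν lam ρ φ g) (hx : x ∈ chart Ω) :
    scalarCurvature g x = Real.exp (κ * ρ (x 0) (x 1)) *
      (scalarBondi ν lam (x 0) (x 1) + 3 * κ * boxBondi ν lam ρ (x 0) (x 1)
        + 3 * κ ^ 2 * Real.exp (-ν (x 0) (x 1) - lam (x 0) (x 1)) *
          lightD ν lam ρ (x 0) (x 1) * dr ρ (x 0) (x 1)) := by
  have h1 : du (dr (fun u r => ν u r + lam u r)) (x 0) (x 1) =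
      du (dr ν) (x 0) (x 1) + du (dr lam) (x 0) (x 1) := by
    refine (du_congr h.isOpen hx.1 (fun u r hx => h.dr_add hx)).trans ?_
    exact ((hasDerivAt_du one_ne_zero h.isOpen (contDiffOn_dr h.isOpen h.smooth_ν) hx.1).add
      (hasDerivAt_du one_ne_zero h.isOpen (contDiffOn_dr h.isOpen h.smooth_lam) hx.1)).deriv
  rw [scalarCurvature_congr (isOpen_chart h.isOpen) h.g_eq hx, h.scalarCurvature_eq hx,
    scalarBondi, boxBondi, h1, h.dr_sub hx.1, h.dr_exp_sub hx.1,
    lightD_dr_mul h.isOpen h.smooth_ρ hx.1, transport, lightD]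
  ring

/-- As `∂_r` is null the coefficient of `g` disappears, and the term in `∂_r²ρ` from the Ricci
tensor cancels the one from the Hessian of `e^{κρ}`. -/
theorem fieldResidual_one_one (h : BondiFrame κ I f Ω ν lam ρ φ g) (U : ℝ → ℝ)
    (hx : x ∈ chart Ω) :
    fieldResidual f U g φ x 1 1 = 2 / x 1 * Real.exp (κ * ρ (x 0) (x 1)) *
      radialSumRes κ ν lam ρ φ (x 0) (x 1) := by
  have hr := h.radius_pos _ _ hx.1
  have hS := contDiffOn_logRadius h.radius_pos
  obtain ⟨n1, n2, n3, n4, n5⟩ := conf_derivs (κ := κ) h.isOpen h.smooth_ν h.smooth_ρ hx.1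
  obtain ⟨l1, l2, l3, l4, l5⟩ := conf_derivs (κ := κ) h.isOpen h.smooth_lam h.smooth_ρ hx.1
  obtain ⟨s1, s2, s3, s4, s5⟩ := conf_derivs (κ := κ) h.isOpen hS h.smooth_ρ hx.1
  obtain ⟨q1, q2, q3, q4, q5⟩ := logRadius_derivs h.isOpen hx.1
  obtain ⟨f1, f2, f3, f4, f5⟩ := expMul_derivs (κ := κ) h.isOpen h.smooth_ρ hx.1
  obtain ⟨e1, e2, -, -⟩ := exp_kappa κ (ρ (x 0) (x 1))
  have hh := Real.exp_ne_zero (κ / 2 * ρ (x 0) (x 1))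
  rw [h.fieldResidual_eq U hx]
  simp only [sphericalRicci, sphericalComponents, sphericalHessian, warpRR, pd_one_lift,
    n2, l2, s2, s5, q2, q5, f2, f5, Pi.zero_apply]
  simp only [lift, radialSumRes, e1, e2]
  field_simp
  ring

/-- The left side is `X(D, ∂_r)`. Here the coefficient of `g` survives, and its wave operator and
scalar curvature cancel every second derivative in the Ricci and Hessian terms. -/
theorem fieldResidual_light_one (h : BondiFrame κ I f Ω ν lam ρ φ g) (U : ℝ → ℝ)
    (hx : x ∈ chart Ω) :
    fieldResidual f U g φ x 0 1
        - 1 / 2 * Real.exp (ν (x 0) (x 1) - lam (x 0) (x 1)) * fieldResidual f U g φ x 1 1 =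
      -(Real.exp (κ * ρ (x 0) (x 1)) / x 1 ^ 2) *
        radialDiffRes κ f U I ν lam ρ φ (x 0) (x 1) := by
  have hr := h.radius_pos _ _ hx.1
  have hS := contDiffOn_logRadius h.radius_pos
  obtain ⟨n1, n2, n3, n4, n5⟩ := conf_derivs (κ := κ) h.isOpen h.smooth_ν h.smooth_ρ hx.1
  obtain ⟨l1, l2, l3, l4, l5⟩ := conf_derivs (κ := κ) h.isOpen h.smooth_lam h.smooth_ρ hx.1
  obtain ⟨s1, s2, s3, s4, s5⟩ := conf_derivs (κ := κ) h.isOpen hS h.smooth_ρ hx.1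
  obtain ⟨q1, q2, q3, q4, q5⟩ := logRadius_derivs h.isOpen hx.1
  obtain ⟨f1, f2, f3, f4, f5⟩ := expMul_derivs (κ := κ) h.isOpen h.smooth_ρ hx.1
  obtain ⟨e1, e2, e3, e4⟩ := exp_kappa κ (ρ (x 0) (x 1))
  have hp := Real.exp_ne_zero (ν (x 0) (x 1))
  have hq := Real.exp_ne_zero (lam (x 0) (x 1))
  have hh := Real.exp_ne_zero (κ / 2 * ρ (x 0) (x 1))
  rw [h.fieldResidual_one_one U hx, h.fieldResidual_eq U hx, metricCoeff,
    h.box_phys (contDiffOn_expMul h.smooth_ρ) hx, h.scalarCurvature_eq hx, physMetric,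
    gTrace_gradient_sphericalMetric hx]
  simp only [sphericalRicci, sphericalComponents, sphericalHessian, ricciPlane, warpUR,
    pd_one_lift, pd_zero_lift, sep,
    n2, n4, n5, l2, l4, s1, s2, s4, q1, q2, q4, f1, f2, f4, f5]
  simp only [lift, radialDiffRes, radialSumRes, conf, Real.exp_add, Real.exp_sub, Real.exp_neg,
    exp_two_mul, exp_neg_two_mul, e1, e2, e4]
  field_simp
  ring

/-- The left side is `X(D, D)`. The vector `D` is null too, so the coefficient of `g` need not be
expanded. -/
theorem fieldResidual_light_light (h : BondiFrame κ I f Ω ν lam ρ φ g) (U : ℝ → ℝ)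
    (hx : x ∈ chart Ω) :
    fieldResidual f U g φ x 0 0
        - Real.exp (ν (x 0) (x 1) - lam (x 0) (x 1)) * fieldResidual f U g φ x 0 1
        + 1 / 4 * Real.exp (ν (x 0) (x 1) - lam (x 0) (x 1)) ^ 2 * fieldResidual f U g φ x 1 1 =
      Real.exp (κ * ρ (x 0) (x 1)) / x 1 ^ 2 * lightRes κ ν lam ρ φ (x 0) (x 1) := by
  have hr := h.radius_pos _ _ hx.1
  have hS := contDiffOn_logRadius h.radius_pos
  obtain ⟨n1, n2, n3, n4, n5⟩ := conf_derivs (κ := κ) h.isOpen h.smooth_ν h.smooth_ρ hx.1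
  obtain ⟨l1, l2, l3, l4, l5⟩ := conf_derivs (κ := κ) h.isOpen h.smooth_lam h.smooth_ρ hx.1
  obtain ⟨s1, s2, s3, s4, s5⟩ := conf_derivs (κ := κ) h.isOpen hS h.smooth_ρ hx.1
  obtain ⟨q1, q2, q3, q4, q5⟩ := logRadius_derivs h.isOpen hx.1
  obtain ⟨f1, f2, f3, f4, f5⟩ := expMul_derivs (κ := κ) h.isOpen h.smooth_ρ hx.1
  obtain ⟨e1, e2, e3, e4⟩ := exp_kappa κ (ρ (x 0) (x 1))
  have hp := Real.exp_ne_zero (ν (x 0) (x 1))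
  have hq := Real.exp_ne_zero (lam (x 0) (x 1))
  have hh := Real.exp_ne_zero (κ / 2 * ρ (x 0) (x 1))
  simp only [h.fieldResidual_eq U hx]
  simp only [sphericalRicci, sphericalComponents, sphericalHessian, ricciPlane, warpUR, warpUU,
    warpRR, pd_one_lift, pd_zero_lift, sep, Pi.zero_apply,
    n1, n2, n4, n5, l1, l2, l4, s1, s2, s3, s4, s5, q1, q2, q3, q4, q5, f1, f2, f3, f4, f5]
  simp only [lift, lightRes, lightD, conf, Real.exp_add, Real.exp_sub, e1, e2]
  field_simp
  ring

end BondiFrame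

/-! ### Components, trace and block structure of the residual -/

theorem comp_fieldResidual (f U : ℝ → ℝ) (g : TensorField) (φ : ℝ → ℝ → ℝ) (x : Coord)
    (X Y : Fin 4 → ℝ) :
    comp (fieldResidual f U g φ x) X Y =
      comp (modGravity f g x) X Y - 8 * Real.pi * comp (stressEnergy U g (lift φ) x) X Y := by
  simp only [comp, fieldResidual, Fin.sum_univ_four]
  ring

theorem componentAt_iff {f U : ℝ → ℝ} {g : TensorField} {φ : ℝ → ℝ → ℝ} {x : Coord}
    {X Y : Fin 4 → ℝ} :
    ComponentAt f U g φ x X Y ↔ comp (fieldResidual f U g φ x) X Y = 0 := by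
  rw [comp_fieldResidual, sub_eq_zero, ComponentAt]

theorem gTrace_fieldResidual (f U : ℝ → ℝ) (g : TensorField) (φ : ℝ → ℝ → ℝ) (x : Coord) :
    gTrace g (fieldResidual f U g φ) x =
      gTrace g (modGravity f g) x - 8 * Real.pi * gTrace g (stressEnergy U g (lift φ)) x := by
  simp only [gTrace, fieldResidual, Fin.sum_univ_four]
  ring

theorem traceAt_iff {f U : ℝ → ℝ} {g : TensorField} {φ : ℝ → ℝ → ℝ} {x : Coord} :
    TraceAt f U g φ x ↔ gTrace g (fieldResidual f U g φ) x = 0 := by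
  rw [gTrace_fieldResidual, sub_eq_zero, TraceAt]

theorem fieldEquationsAt_iff_residual {f U : ℝ → ℝ} {g : TensorField} {φ : ℝ → ℝ → ℝ}
    {x : Coord} :
    FieldEquationsAt f U g φ x ↔ ∀ a b, fieldResidual f U g φ x a b = 0 := by
  simp only [FieldEquationsAt, fieldResidual, sub_eq_zero]

namespace BondiFrame

variable {κ : ℝ} {I : Set ℝ} {f : ℝ → ℝ} {Ω : Set (ℝ × ℝ)} {ν lam ρ φ : ℝ → ℝ → ℝ}
  {g : TensorField} {x : Coord}

/-- Spherical symmetry leaves only the components `uu`, `ur`, `rr`, `θθ` to be controlled. -/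
theorem fieldResidual_offdiag (h : BondiFrame κ I f Ω ν lam ρ φ g) (U : ℝ → ℝ)
    (hx : x ∈ chart Ω) :
    fieldResidual f U g φ x 1 0 = fieldResidual f U g φ x 0 1 ∧
    fieldResidual f U g φ x 0 2 = 0 ∧ fieldResidual f U g φ x 0 3 = 0 ∧
    fieldResidual f U g φ x 1 2 = 0 ∧ fieldResidual f U g φ x 1 3 = 0 ∧
    fieldResidual f U g φ x 2 0 = 0 ∧ fieldResidual f U g φ x 2 1 = 0 ∧
    fieldResidual f U g φ x 2 3 = 0 ∧ fieldResidual f U g φ x 3 0 = 0 ∧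
    fieldResidual f U g φ x 3 1 = 0 ∧ fieldResidual f U g φ x 3 2 = 0 ∧
    fieldResidual f U g φ x 3 3 = fieldResidual f U g φ x 2 2 * Real.sin (x 2) ^ 2 := by
  simp only [h.fieldResidual_eq U hx]
  refine ⟨?_, ?_, ?_, ?_, ?_, ?_, ?_, ?_, ?_, ?_, ?_, ?_⟩ <;>
    simp only [sphericalRicci, sphericalComponents, sphericalHessian, sep, pd_zero_lift,
      pd_one_lift, pd_two_lift, pd_three_lift, Pi.zero_apply] <;>
    ring

theorem gTrace_fieldResidual_eq_components (h : BondiFrame κ I f Ω ν lam ρ φ g) (U : ℝ → ℝ)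
    (hx : x ∈ chart Ω) :
    gTrace g (fieldResidual f U g φ) x =
      -2 * Real.exp (-conf κ ν ρ (x 0) (x 1) - conf κ lam ρ (x 0) (x 1)) *
          fieldResidual f U g φ x 0 1
        + Real.exp (-conf κ lam ρ (x 0) (x 1) - conf κ lam ρ (x 0) (x 1)) *
          fieldResidual f U g φ x 1 1
        + 2 * Real.exp (-conf κ logRadius ρ (x 0) (x 1) - conf κ logRadius ρ (x 0) (x 1)) *
          fieldResidual f U g φ x 2 2 := by
  have hsin : Real.sin (x 2) ≠ 0 := (Real.sin_pos_of_mem_Ioo hx.2).ne'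
  obtain ⟨h1, -, -, -, -, -, -, -, -, -, -, h2⟩ := h.fieldResidual_offdiag U hx
  rw [gTrace_congr h.g_eq (fun y _ => rfl) hx, physMetric, gTrace_sphericalMetric hx, h1, h2]
  field_simp
  ring

/-- A second evaluation of the same trace: contracting the decomposition of `X` gives `e^{κρ} R + 4c
- □e^{κρ} - 8π |∇φ|²`, with `c` the coefficient of `g`. -/
theorem gTrace_fieldResidual_eq_box (h : BondiFrame κ I f Ω ν lam ρ φ g) (U : ℝ → ℝ)
    (hx : x ∈ chart Ω) :
    gTrace g (fieldResidual f U g φ) x =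
      3 * box (physMetric κ ν lam ρ) (lift (expMul κ ρ)) x
        - scalarCurvature (physMetric κ ν lam ρ) x * Real.exp (κ * ρ (x 0) (x 1))
        + 4 * Vstar κ f I (ρ (x 0) (x 1)) + 32 * Real.pi * U (φ (x 0) (x 1))
        + 8 * Real.pi *
          gTrace (physMetric κ ν lam ρ) (fun y c d => pd c (lift φ) y * pd d (lift φ) y) x := by
  have hS := contDiffOn_logRadius h.radius_pos
  have hbox := box_sphericalMetric h.isOpen (contDiffOn_conf (κ := κ) h.smooth_ν h.smooth_ρ)
    (contDiffOn_conf (κ := κ) h.smooth_lam h.smooth_ρ) (contDiffOn_conf (κ := κ) hS h.smooth_ρ)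
    (contDiffOn_expMul (κ := κ) h.smooth_ρ) hx
  have hR := scalarCurvature_sphericalMetric h.isOpen
    (contDiffOn_conf (κ := κ) h.smooth_ν h.smooth_ρ)
    (contDiffOn_conf (κ := κ) h.smooth_lam h.smooth_ρ) (contDiffOn_conf (κ := κ) hS h.smooth_ρ) hx
  have hgr := gTrace_gradient_sphericalMetric (N := conf κ ν ρ) (L := conf κ lam ρ)
    (S := conf κ logRadius ρ) (w := φ) hx
  have hcoeff := metricCoeff.eq_1 κ I f U ν lam ρ φ x
  rw [h.gTrace_fieldResidual_eq_components U hx]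
  simp only [h.fieldResidual_eq U hx]
  rw [← physMetric] at hbox hR hgr
  have hN0 := Real.exp_ne_zero (conf κ ν ρ (x 0) (x 1))
  have hL0 := Real.exp_ne_zero (conf κ lam ρ (x 0) (x 1))
  have hS0 := Real.exp_ne_zero (conf κ logRadius ρ (x 0) (x 1))
  have e1 : Real.exp (-conf κ ν ρ (x 0) (x 1) - conf κ lam ρ (x 0) (x 1)) *
      Real.exp (conf κ ν ρ (x 0) (x 1) + conf κ lam ρ (x 0) (x 1)) = 1 := by
    rw [← Real.exp_add]; simp
  have e2 : Real.exp (-conf κ logRadius ρ (x 0) (x 1) - conf κ logRadius ρ (x 0) (x 1)) *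
      Real.exp (conf κ logRadius ρ (x 0) (x 1) + conf κ logRadius ρ (x 0) (x 1)) = 1 := by
    rw [← Real.exp_add]; simp
  simp only [sphericalRicci, sphericalComponents, sep, pd_zero_lift, pd_one_lift, pd_two_lift,
    lift, Pi.zero_apply] at hgr ⊢
  -- The factor 4 is the trace of `g`: two from the `ur` pair (`e1`) and two from the sphere (`e2`).
  linear_combination 4 * hcoeff + 2 * metricCoeff κ I f U ν lam ρ φ x * (e1 + e2)
    - Real.exp (κ * ρ (x 0) (x 1)) * hR + hbox + 8 * Real.pi * hgr

theorem Wstar_eq (h : BondiFrame κ I f Ω ν lam ρ φ g) (hx : x ∈ chart Ω) :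
    Wstar κ f I (ρ (x 0) (x 1)) =
      (Rstar κ f I (ρ (x 0) (x 1)) * Real.exp (-κ * ρ (x 0) (x 1))
        - 4 * Vstar κ f I (ρ (x 0) (x 1)) * Real.exp (-2 * κ * ρ (x 0) (x 1))) / 6 := by
  obtain ⟨e1, e2, e3, e4⟩ := exp_kappa κ (ρ (x 0) (x 1))
  have hh := Real.exp_ne_zero (κ / 2 * ρ (x 0) (x 1))
  rw [Wstar, h.Rstar_eq hx, h.f_scalar_eq hx, e1, e2, e3, e4]
  field_simp
  ring

/-- Replacing `R` by `R_⋆(ρ)` removes all second derivatives of `ν` and `lam`, leaving a wave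
equation for `ρ`. Its term in `∂_r(e^{ν-lam})` is traded for the right side of (2) to reach (4),
which produces the correction by the residual of (2). -/
theorem gTrace_fieldResidual_eq (h : BondiFrame κ I f Ω ν lam ρ φ g) (U : ℝ → ℝ)
    (hx : x ∈ chart Ω) :
    gTrace g (fieldResidual f U g φ) x =
      -(6 * κ * Real.exp (κ * ρ (x 0) (x 1)) ^ 2 /
          (x 1 * Real.exp (ν (x 0) (x 1) + lam (x 0) (x 1)))) *
        (transportRhoRes κ f U I ν lam ρ φ (x 0) (x 1)
          - dr ρ (x 0) (x 1) / 2 * radialDiffRes κ f U I ν lam ρ φ (x 0) (x 1)) := by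
  have hr := h.radius_pos _ _ hx.1
  have hκ := h.pos
  obtain ⟨f1, f2, f3, f4, f5⟩ := expMul_derivs (κ := κ) h.isOpen h.smooth_ρ hx.1
  obtain ⟨e1, e2, e3, e4⟩ := exp_kappa κ (ρ (x 0) (x 1))
  have hp := Real.exp_ne_zero (ν (x 0) (x 1))
  have hq := Real.exp_ne_zero (lam (x 0) (x 1))
  have hh := Real.exp_ne_zero (κ / 2 * ρ (x 0) (x 1))
  rw [h.gTrace_fieldResidual_eq_box U hx, h.box_phys (contDiffOn_expMul h.smooth_ρ) hx,
    ← scalarCurvature_congr (isOpen_chart h.isOpen) h.g_eq hx, ← h.Rstar_eq hx, physMetric,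
    gTrace_gradient_sphericalMetric hx]
  simp only [f1, f2, f4, f5, radialDiffRes, transportRhoRes, transport, lightD, h.Wstar_eq hx]
  simp only [conf, Real.exp_add, Real.exp_sub, neg_sub, exp_neg_two_mul,
    e1, e2, e4]
  field_simp
  ring

/-! ### The field equations and the essential equations at a point -/

theorem comp_light (h : BondiFrame κ I f Ω ν lam ρ φ g) (U : ℝ → ℝ) (hx : x ∈ chart Ω) :
    comp (fieldResidual f U g φ x) (vecD ν lam x) (vecD ν lam x) =
      Real.exp (κ * ρ (x 0) (x 1)) / x 1 ^ 2 * lightRes κ ν lam ρ φ (x 0) (x 1) := by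
  rw [← h.fieldResidual_light_light U hx]
  obtain ⟨h1, -⟩ := h.fieldResidual_offdiag U hx
  simp [comp, vecD, Fin.sum_univ_four, h1]
  ring

theorem vecN_eq (x : Coord) : vecN ν lam x = Real.exp (-ν (x 0) (x 1)) • vecD ν lam x := by
  ext i
  revert i
  refine forall_fin_four ?_ ?_ ?_ ?_ <;>
    simp [vecN, vecD, Real.exp_neg, Real.exp_sub]
  field_simp

theorem vecN_vecN_iff (h : BondiFrame κ I f Ω ν lam ρ φ g) (U : ℝ → ℝ) (hx : x ∈ chart Ω) :
    ComponentAt f U g φ x (vecN ν lam x) (vecN ν lam x) ↔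
      lightRes κ ν lam ρ φ (x 0) (x 1) = 0 := by
  have hr := h.radius_pos _ _ hx.1
  have h1 : comp (fieldResidual f U g φ x) (vecN ν lam x) (vecN ν lam x) =
      Real.exp (-ν (x 0) (x 1)) ^ 2 * comp (fieldResidual f U g φ x) (vecD ν lam x) (vecD ν lam x) := by
    simp only [comp, vecN_eq, Fin.sum_univ_four, Pi.smul_apply, smul_eq_mul]
    ring
  rw [componentAt_iff, h1, h.comp_light U hx]
  simp [hr.ne']

theorem vecL_vecL_iff (h : BondiFrame κ I f Ω ν lam ρ φ g) (U : ℝ → ℝ) (hx : x ∈ chart Ω) :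
    ComponentAt f U g φ x (vecL lam x) (vecL lam x) ↔
      radialSumRes κ ν lam ρ φ (x 0) (x 1) = 0 := by
  have hr := h.radius_pos _ _ hx.1
  have h1 : comp (fieldResidual f U g φ x) (vecL lam x) (vecL lam x) =
      Real.exp (-lam (x 0) (x 1)) ^ 2 * fieldResidual f U g φ x 1 1 := by
    simp [comp, vecL, Fin.sum_univ_four]
    ring
  rw [componentAt_iff, h1, h.fieldResidual_one_one U hx]
  simp [hr.ne']

theorem vecN_vecL_iff (h : BondiFrame κ I f Ω ν lam ρ φ g) (U : ℝ → ℝ) (hx : x ∈ chart Ω) :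
    ComponentAt f U g φ x (vecN ν lam x) (vecL lam x) ↔
      radialDiffRes κ f U I ν lam ρ φ (x 0) (x 1) = 0 := by
  have hr := h.radius_pos _ _ hx.1
  have h1 : comp (fieldResidual f U g φ x) (vecN ν lam x) (vecL lam x) =
      Real.exp (-ν (x 0) (x 1)) * Real.exp (-lam (x 0) (x 1)) * (fieldResidual f U g φ x 0 1
        - 1 / 2 * Real.exp (ν (x 0) (x 1) - lam (x 0) (x 1)) * fieldResidual f U g φ x 1 1) := by
    rw [vecN_eq]
    simp [comp, vecL, vecD, Fin.sum_univ_four]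
    ring
  rw [componentAt_iff, h1, h.fieldResidual_light_one U hx]
  simp [hr.ne']

theorem vecZ₁_iff (h : BondiFrame κ I f Ω ν lam ρ φ g) (U : ℝ → ℝ) (hx : x ∈ chart Ω) :
    ComponentAt f U g φ x (vecZ₁ x) (vecZ₁ x) ↔ fieldResidual f U g φ x 2 2 = 0 := by
  have hr := h.radius_pos _ _ hx.1
  rw [componentAt_iff]
  simp [comp, vecZ₁, Fin.sum_univ_four, hr.ne']

theorem vecZ₂_iff (h : BondiFrame κ I f Ω ν lam ρ φ g) (U : ℝ → ℝ) (hx : x ∈ chart Ω) :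
    ComponentAt f U g φ x (vecZ₂ x) (vecZ₂ x) ↔ fieldResidual f U g φ x 2 2 = 0 := by
  have hr := h.radius_pos _ _ hx.1
  have hsin : Real.sin (x 2) ≠ 0 := (Real.sin_pos_of_mem_Ioo hx.2).ne'
  obtain ⟨-, -, -, -, -, -, -, -, -, -, -, h2⟩ := h.fieldResidual_offdiag U hx
  rw [componentAt_iff]
  simp [comp, vecZ₂, Fin.sum_univ_four, hr.ne', hsin, h2]

theorem traceAt_iff_transportRho (h : BondiFrame κ I f Ω ν lam ρ φ g) (U : ℝ → ℝ)
    (hx : x ∈ chart Ω) (hD : radialDiffRes κ f U I ν lam ρ φ (x 0) (x 1) = 0) :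
    TraceAt f U g φ x ↔ transportRhoRes κ f U I ν lam ρ φ (x 0) (x 1) = 0 := by
  have hr := h.radius_pos _ _ hx.1
  rw [traceAt_iff, h.gTrace_fieldResidual_eq U hx, hD]
  simp [hr.ne', h.pos.ne']

theorem kleinGordonAt_iff (h : BondiFrame κ I f Ω ν lam ρ φ g) (U : ℝ → ℝ) (hx : x ∈ chart Ω) :
    KleinGordonAt U g φ x ↔ transportPhiRes κ U ν lam ρ φ (x 0) (x 1) = 0 := by
  have hr := h.radius_pos _ _ hx.1
  rw [KleinGordonAt, ← sub_eq_zero, h.box_sub_eq U hx]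
  simp [hr.ne']

/-- The sphere component is recovered from the trace. The `uu` component does not interfere, because
`g^{uu} = 0`. -/
theorem fieldResidual_eq_zero (h : BondiFrame κ I f Ω ν lam ρ φ g) {U : ℝ → ℝ}
    (hx : x ∈ chart Ω) (hS : radialSumRes κ ν lam ρ φ (x 0) (x 1) = 0)
    (hD : radialDiffRes κ f U I ν lam ρ φ (x 0) (x 1) = 0)
    (hT : transportRhoRes κ f U I ν lam ρ φ (x 0) (x 1) = 0) :
    fieldResidual f U g φ x 1 1 = 0 ∧ fieldResidual f U g φ x 0 1 = 0 ∧
      fieldResidual f U g φ x 2 2 = 0 := by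
  have h11 : fieldResidual f U g φ x 1 1 = 0 := by rw [h.fieldResidual_one_one U hx, hS, mul_zero]
  have h01 : fieldResidual f U g φ x 0 1 = 0 := by
    have := h.fieldResidual_light_one U hx
    rwa [h11, hD, mul_zero, mul_zero, sub_zero] at this
  refine ⟨h11, h01, ?_⟩
  have := h.gTrace_fieldResidual_eq U hx
  rw [h.gTrace_fieldResidual_eq_components U hx, hD, hT, h11, h01] at this
  simpa using this

theorem fieldEquationsAt_iff (h : BondiFrame κ I f Ω ν lam ρ φ g) (U : ℝ → ℝ)
    (hx : x ∈ chart Ω) :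
    FieldEquationsAt f U g φ x ↔
      radialSumRes κ ν lam ρ φ (x 0) (x 1) = 0 ∧
      radialDiffRes κ f U I ν lam ρ φ (x 0) (x 1) = 0 ∧
      transportRhoRes κ f U I ν lam ρ φ (x 0) (x 1) = 0 ∧
      lightRes κ ν lam ρ φ (x 0) (x 1) = 0 := by
  have hr := h.radius_pos _ _ hx.1
  rw [fieldEquationsAt_iff_residual]
  constructor
  · intro hX
    have hcomp : ∀ X Y, ComponentAt f U g φ x X Y := fun X Y => by
      rw [componentAt_iff]
      simp [comp, hX]
    have hD := (h.vecN_vecL_iff U hx).1 (hcomp _ _)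
    refine ⟨(h.vecL_vecL_iff U hx).1 (hcomp _ _), hD, ?_, (h.vecN_vecN_iff U hx).1 (hcomp _ _)⟩
    rw [← h.traceAt_iff_transportRho U hx hD, traceAt_iff]
    simp [gTrace, hX]
  · rintro ⟨hS, hD, hT, hQ⟩
    obtain ⟨h11, h01, h22⟩ := h.fieldResidual_eq_zero hx hS hD hT
    have h00 := h.fieldResidual_light_light U hx
    rw [h11, h01, hQ] at h00
    simp only [mul_zero, sub_zero, add_zero] at h00
    obtain ⟨h10, h02, h03, h12, h13, h20, h21, h23, h30, h31, h32, h33⟩ :=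
      h.fieldResidual_offdiag U hx
    rw [h01] at h10
    rw [h22, zero_mul] at h33
    exact forall_fin_four (forall_fin_four h00 h01 h02 h03) (forall_fin_four h10 h11 h12 h13)
      (forall_fin_four h20 h21 h22 h23) (forall_fin_four h30 h31 h32 h33)

end BondiFrame

/-! ### The derivative of the potential `V` -/

section Potential

variable {κ : ℝ} {I : Set ℝ} {f : ℝ → ℝ}

/-- A continuous injective function on an interval takes at each point of a subinterval a value
between the values at the end points. -/
theorem mem_uIcc_of_injOn {p : ℝ → ℝ} {a b : ℝ} (hab : a ≤ b) (hc : ContinuousOn p (Icc a b))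
    (hi : InjOn p (Icc a b)) {x y z : ℝ} (hx : x ∈ Icc a b) (hy : y ∈ Icc a b)
    (hz : z ∈ uIcc x y) : p z ∈ uIcc (p x) (p y) := by
  have hsub : uIcc x y ⊆ Icc a b := uIcc_subset_Icc hx hy
  have hz' := hsub hz
  rcases hc.strictMonoOn_of_injOn_Icc' hab hi with hm | hm
  · have := (hm.monotoneOn.mono hsub).mapsTo_uIcc
    exact this hz
  · have := (hm.antitoneOn.mono hsub).mapsTo_uIcc
    exact this hz

/-- A continuous injective `f'` is strictly monotone near `R₀`, so by the intermediate value theorem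
it attains every value near `e^{κ s₀}` close to `R₀`. The inverse function theorem is not available,
since `f''` may vanish. -/
theorem eventually_Rstar (hκ : κ ≠ 0) (hc : ContinuousOn (deriv f) I)
    (hpos : ∀ R ∈ I, 0 < deriv f R) (hinj : Set.InjOn (deriv f) I) {R₀ s₀ : ℝ}
    (hs : deriv f R₀ = Real.exp (κ * s₀)) {δ : ℝ} (hδ : 0 < δ) (hsub : Icc (R₀ - δ) (R₀ + δ) ⊆ I) :
    ∀ᶠ s in 𝓝 s₀, Rstar κ f I s ∈ Ioo (R₀ - δ) (R₀ + δ) ∧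
      deriv f (Rstar κ f I s) = Real.exp (κ * s) := by
  have hle : R₀ - δ ≤ R₀ + δ := by linarith
  have hc' := hc.mono hsub
  have hi' := hinj.mono hsub
  have m1 : R₀ - δ ∈ Icc (R₀ - δ) (R₀ + δ) := ⟨le_rfl, hle⟩
  have m2 : R₀ + δ ∈ Icc (R₀ - δ) (R₀ + δ) := ⟨hle, le_rfl⟩
  have m0 : R₀ ∈ Icc (R₀ - δ) (R₀ + δ) := ⟨by linarith, by linarith⟩
  have hexp : Continuous fun s => Real.exp (κ * s) := by fun_prop
  have key : ∀ᶠ s in 𝓝 s₀, ∃ R ∈ Ioo (R₀ - δ) (R₀ + δ), deriv f R = Real.exp (κ * s) := by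
    rcases hc'.strictMonoOn_of_injOn_Icc' hle hi' with hm | hm
    · have h1 := hm m1 m0 (by linarith)
      have h2 := hm m0 m2 (by linarith)
      rw [hs] at h1 h2
      filter_upwards [hexp.continuousAt.eventually_mem (Ioo_mem_nhds h1 h2)] with s h3
      exact intermediate_value_Ioo hle hc' h3
    · have h1 := hm m1 m0 (by linarith)
      have h2 := hm m0 m2 (by linarith)
      rw [hs] at h1 h2
      filter_upwards [hexp.continuousAt.eventually_mem (Ioo_mem_nhds h2 h1)] with s h3
      exact intermediate_value_Ioo' hle hc' h3
  filter_upwards [key] with s ⟨R, hR1, hR2⟩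
  rw [Rstar_of_deriv_eq hκ hpos hinj (hsub (Ioo_subset_Icc_self hR1)) hR2]
  exact ⟨hR1, hR2⟩

/-- The potential `V` is half the Legendre transform of `f`, as a function of `f' = e^{κ s}`. -/
theorem hasDerivAt_Vstar (hκ : κ ≠ 0) (hI : IsOpen I) (hf : ContDiffOn ℝ 2 f I)
    (hpos : ∀ R ∈ I, 0 < deriv f R) (hinj : Set.InjOn (deriv f) I) {R₀ s₀ : ℝ} (hR : R₀ ∈ I)
    (hs : deriv f R₀ = Real.exp (κ * s₀)) :
    HasDerivAt (Vstar κ f I) (κ / 2 * Real.exp (κ * s₀) * R₀) s₀ := by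
  have hc : ContinuousOn (deriv f) I := hf.continuousOn_deriv_of_isOpen hI (by norm_num)
  have hd : ∀ R ∈ I, DifferentiableAt ℝ f R := fun R hR =>
    (hf.contDiffAt (hI.mem_nhds hR)).differentiableAt two_ne_zero
  obtain ⟨ε, hε, hball⟩ := Metric.isOpen_iff.1 hI R₀ hR
  have hIcc : ∀ δ < ε, Icc (R₀ - δ) (R₀ + δ) ⊆ I := by
    intro δ hδ x hx
    refine hball ?_
    rw [Metric.mem_ball, Real.dist_eq, abs_lt]
    constructor <;> linarith [hx.1, hx.2]
  have hR0 : Rstar κ f I s₀ = R₀ := Rstar_of_deriv_eq hκ hpos hinj hR hs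
  have hexp : HasDerivAt (fun s => Real.exp (κ * s)) (Real.exp (κ * s₀) * κ) s₀ := by
    simpa using ((hasDerivAt_id s₀).const_mul κ).exp
  have hcont : Tendsto (Rstar κ f I) (𝓝 s₀) (𝓝 R₀) := by
    rw [Metric.tendsto_nhds]
    intro η hη
    have hδ : 0 < min η (ε / 2) := lt_min hη (by linarith)
    filter_upwards [eventually_Rstar hκ hc hpos hinj hs hδ
      (hIcc _ (lt_of_le_of_lt (min_le_right _ _) (by linarith)))] with s h1
    rw [Real.dist_eq, abs_lt]
    have := min_le_left η (ε / 2)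
    constructor <;> linarith [h1.1.1, h1.1.2]
  -- `R_⋆` need not be differentiable, so the chain rule is avoided: `E` is the error in
  -- approximating `V_⋆` by an affine function of `e^{κ s}` of slope `R₀/2`, and it is shown to be
  -- `o(s - s₀)`.
  set E : ℝ → ℝ := fun s => Vstar κ f I s - Vstar κ f I s₀
    - R₀ / 2 * (Real.exp (κ * s) - Real.exp (κ * s₀)) with hE
  have hbound : ∀ᶠ s in 𝓝 s₀,
      ‖E s‖ ≤ ‖(Rstar κ f I s - R₀) * (Real.exp (κ * s) - Real.exp (κ * s₀))‖ := by
    filter_upwards [eventually_Rstar hκ hc hpos hinj hs (half_pos hε)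
      (hIcc _ (by linarith))] with s ⟨h1, h2⟩
    have hsub := hIcc (ε / 2) (by linarith)
    have hm0 : R₀ ∈ Icc (R₀ - ε / 2) (R₀ + ε / 2) := ⟨by linarith, by linarith⟩
    have hm1 := Ioo_subset_Icc_self h1
    have hseg : uIcc R₀ (Rstar κ f I s) ⊆ I := (uIcc_subset_Icc hm0 hm1).trans hsub
    obtain ⟨ξ, hξ, hslope⟩ : ∃ ξ ∈ uIcc R₀ (Rstar κ f I s),
        f (Rstar κ f I s) - f R₀ = deriv f ξ * (Rstar κ f I s - R₀) := by
      rcases lt_trichotomy R₀ (Rstar κ f I s) with hlt | heq | hgt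
      · rw [uIcc_of_le hlt.le] at hseg
        obtain ⟨ξ, h3, h4⟩ := exists_deriv_eq_slope f hlt
          (fun y hy => (hd y (hseg hy)).continuousAt.continuousWithinAt)
          (fun y hy => (hd y (hseg (Ioo_subset_Icc_self hy))).differentiableWithinAt)
        refine ⟨ξ, by rw [uIcc_of_le hlt.le]; exact Ioo_subset_Icc_self h3, ?_⟩
        rw [h4, div_mul_cancel₀ _ (sub_ne_zero.2 hlt.ne')]
      · exact ⟨R₀, left_mem_uIcc, by rw [← heq]; ring⟩
      · rw [uIcc_of_ge hgt.le] at hseg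
        obtain ⟨ξ, h3, h4⟩ := exists_deriv_eq_slope f hgt
          (fun y hy => (hd y (hseg hy)).continuousAt.continuousWithinAt)
          (fun y hy => (hd y (hseg (Ioo_subset_Icc_self hy))).differentiableWithinAt)
        refine ⟨ξ, by rw [uIcc_of_ge hgt.le]; exact Ioo_subset_Icc_self h3, ?_⟩
        rw [h4]
        have := sub_ne_zero.2 hgt.ne'
        field_simp
        ring
    -- With `f(R_⋆) - f(R₀) = f'(ξ) (R_⋆ - R₀)` the error is `(R_⋆ - R₀)(e^{κ s} - f'(ξ)) / 2`.
    -- Monotonicity puts `f'(ξ)` between `e^{κ s₀}` and `e^{κ s}`, which bounds the error by an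
    -- `o(1)` times an `O(s - s₀)`.
    have hmem := mem_uIcc_of_injOn (by linarith) (hc.mono hsub) (hinj.mono hsub) hm0 hm1 hξ
    rw [h2, hs] at hmem
    have hE' : E s = 1 / 2 * ((Rstar κ f I s - R₀) * (Real.exp (κ * s) - deriv f ξ)) := by
      simp only [hE, Vstar, hR0, h2, hs]
      linear_combination (-1 / 2) * hslope
    have hle := abs_sub_right_of_mem_uIcc hmem
    rw [hE', norm_mul, norm_mul, norm_mul]
    simp only [Real.norm_eq_abs]
    have h5 : |Real.exp (κ * s) - deriv f ξ| ≤ |Real.exp (κ * s) - Real.exp (κ * s₀)| := hle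
    have h6 : |(1 / 2 : ℝ)| ≤ 1 := by norm_num [abs_of_pos]
    calc |(1 / 2 : ℝ)| * (|Rstar κ f I s - R₀| * |Real.exp (κ * s) - deriv f ξ|)
        ≤ 1 * (|Rstar κ f I s - R₀| * |Real.exp (κ * s) - Real.exp (κ * s₀)|) := by gcongr
      _ = _ := one_mul _
  have hsmall : (fun s => Rstar κ f I s - R₀) =o[𝓝 s₀] (fun _ => (1 : ℝ)) := by
    rw [Asymptotics.isLittleO_one_iff]
    simpa using hcont.sub_const R₀
  have hEo : E =o[𝓝 s₀] fun s => s - s₀ := by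
    refine (Asymptotics.IsBigO.of_bound 1 ?_).trans_isLittleO
      ((hsmall.mul_isBigO hexp.isBigO_sub).congr_right fun s => one_mul _)
    filter_upwards [hbound] with s h1
    rwa [one_mul]
  have hE0 : HasDerivAt E 0 s₀ := by
    rw [hasDerivAt_iff_isLittleO]
    have hz : E s₀ = 0 := by simp [hE]
    simpa [hz] using hEo
  have hV : Vstar κ f I = fun s => E s + (Vstar κ f I s₀
      + R₀ / 2 * (Real.exp (κ * s) - Real.exp (κ * s₀))) := by
    ext s
    simp only [hE]
    ring
  rw [hV]
  refine (hE0.add (((hexp.sub_const _).const_mul (R₀ / 2)).const_add _)).congr_deriv ?_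
  ring

end Potential

/-! ### Differentiated radial equations -/

/-- The scalar residuals depend on `(u, r)` alone, so one point of the sphere over each `(u, r)` is
enough. -/
theorem mem_chart_equator {Ω : Set (ℝ × ℝ)} {u r : ℝ} (hx : (u, r) ∈ Ω) :
    (![u, r, Real.pi / 2, 0] : Coord) ∈ chart Ω :=
  ⟨hx, by simp [Real.pi_pos], by simp [Real.pi_pos]⟩

section Vanish

variable {Ω : Set (ℝ × ℝ)} {F : ℝ → ℝ → ℝ} {u r e : ℝ}

theorem deriv_eq_zero_of_vanish_u (hΩ : IsOpen Ω) (hx : (u, r) ∈ Ω)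
    (hF : ∀ u r, (u, r) ∈ Ω → F u r = 0) (hd : HasDerivAt (fun t => F t r) e u) : e = 0 :=
  hd.deriv.symm.trans ((du_congr (w := fun _ _ => 0) hΩ hx hF).trans (deriv_const _ _))

theorem deriv_eq_zero_of_vanish_r (hΩ : IsOpen Ω) (hx : (u, r) ∈ Ω)
    (hF : ∀ u r, (u, r) ∈ Ω → F u r = 0) (hd : HasDerivAt (fun t => F u t) e r) : e = 0 :=
  hd.deriv.symm.trans ((dr_congr (w := fun _ _ => 0) hΩ hx hF).trans (deriv_const _ _))

end Vanish

theorem exp_neg_two_kappa (κ s : ℝ) : Real.exp (-2 * κ * s) = Real.exp (-κ * s) ^ 2 := by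
  rw [← Real.exp_nat_mul]; congr 1; push_cast; ring

theorem exp_neg_two_kappa_mul (κ s : ℝ) :
    Real.exp (-κ * s) ^ 2 * Real.exp (κ * s) = Real.exp (-κ * s) := by
  rw [← exp_neg_two_kappa, ← Real.exp_add]; congr 1; ring

namespace BondiFrame

variable {κ : ℝ} {I : Set ℝ} {f U : ℝ → ℝ} {Ω : Set (ℝ × ℝ)} {ν lam ρ φ : ℝ → ℝ → ℝ}
  {g : TensorField} {u r : ℝ}

theorem hasDerivAt_Vstar_ρ (h : BondiFrame κ I f Ω ν lam ρ φ g) (hI : IsOpen I)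
    (hf : ContDiffOn ℝ 2 f I) (hx : (u, r) ∈ Ω) :
    HasDerivAt (Vstar κ f I)
      (κ / 2 * Real.exp (κ * ρ u r) * Rstar κ f I (ρ u r)) (ρ u r) := by
  have hc := mem_chart_equator hx
  have hR : Rstar κ f I (ρ u r) = _ := h.Rstar_eq hc
  rw [hR]
  exact hasDerivAt_Vstar h.pos.ne' hI hf h.deriv_pos h.deriv_inj (h.scalar_mem _ hc)
    (h.fPrimeR_eq hc)

theorem radialSum_du (h : BondiFrame κ I f Ω ν lam ρ φ g)
    (hS : ∀ u r, (u, r) ∈ Ω → radialSumRes κ ν lam ρ φ u r = 0) (hx : (u, r) ∈ Ω) :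
    du (dr ν) u r + du (dr lam) u r - (3 / 2 * κ ^ 2 * r * dr ρ u r * du (dr ρ) u r
      + 4 * Real.pi * r * Real.exp (-κ * ρ u r) *
        (2 * dr φ u r * du (dr φ) u r - κ * du ρ u r * dr φ u r ^ 2)) = 0 := by
  have ho := h.isOpen
  have hρ := hasDerivAt_du two_ne_zero ho h.smooth_ρ hx
  have hνr := hasDerivAt_du one_ne_zero ho (contDiffOn_dr ho h.smooth_ν) hx
  have hlr := hasDerivAt_du one_ne_zero ho (contDiffOn_dr ho h.smooth_lam) hx
  have hρr := hasDerivAt_du one_ne_zero ho (contDiffOn_dr ho h.smooth_ρ) hx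
  have hφr := hasDerivAt_du one_ne_zero ho (contDiffOn_dr ho h.smooth_φ) hx
  have hd := (hνr.add hlr).sub (((hρr.pow 2).const_mul (3 / 4 * κ ^ 2 * r)).add
    (((hρ.const_mul (-κ)).exp.const_mul (4 * Real.pi * r)).mul (hφr.pow 2)))
  have h0 := deriv_eq_zero_of_vanish_u ho hx hS hd
  simp only [Pi.pow_apply] at h0
  rw [← h0]
  push_cast
  ring

theorem radialSum_dr (h : BondiFrame κ I f Ω ν lam ρ φ g)
    (hS : ∀ u r, (u, r) ∈ Ω → radialSumRes κ ν lam ρ φ u r = 0) (hx : (u, r) ∈ Ω) :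
    dr (dr ν) u r + dr (dr lam) u r - (3 / 4 * κ ^ 2 * dr ρ u r ^ 2
      + 3 / 2 * κ ^ 2 * r * dr ρ u r * dr (dr ρ) u r
      + 4 * Real.pi * Real.exp (-κ * ρ u r) * dr φ u r ^ 2
      + 4 * Real.pi * r * Real.exp (-κ * ρ u r) *
        (2 * dr φ u r * dr (dr φ) u r - κ * dr ρ u r * dr φ u r ^ 2)) = 0 := by
  have ho := h.isOpen
  have hρ := hasDerivAt_dr two_ne_zero ho h.smooth_ρ hx
  have hνr := hasDerivAt_dr one_ne_zero ho (contDiffOn_dr ho h.smooth_ν) hx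
  have hlr := hasDerivAt_dr one_ne_zero ho (contDiffOn_dr ho h.smooth_lam) hx
  have hρr := hasDerivAt_dr one_ne_zero ho (contDiffOn_dr ho h.smooth_ρ) hx
  have hφr := hasDerivAt_dr one_ne_zero ho (contDiffOn_dr ho h.smooth_φ) hx
  have hid := hasDerivAt_id' r
  have hd := (hνr.add hlr).sub (((hid.const_mul (3 / 4 * κ ^ 2)).mul (hρr.pow 2)).add
    (((hid.const_mul (4 * Real.pi)).mul (hρ.const_mul (-κ)).exp).mul (hφr.pow 2)))
  have h0 := deriv_eq_zero_of_vanish_r ho hx hS hd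
  simp only [Pi.pow_apply, Pi.mul_apply] at h0
  rw [← h0]
  push_cast
  ring

/-- The derivative `V_⋆'(ρ)` is replaced by `(κ/2) e^{κρ} R_⋆(ρ)`, which can be matched with the
`R_⋆` inside `W_⋆` in (4). -/
theorem radialDiff_du (h : BondiFrame κ I f Ω ν lam ρ φ g) (hI : IsOpen I)
    (hf : ContDiffOn ℝ 2 f I) (hU : Differentiable ℝ U)
    (hD : ∀ u r, (u, r) ∈ Ω → radialDiffRes κ f U I ν lam ρ φ u r = 0) (hx : (u, r) ∈ Ω) :
    Real.exp (ν u r - lam u r) * ((du ν u r - du lam u r) * (1 + r * (dr ν u r - dr lam u r))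
        + r * (du (dr ν) u r - du (dr lam) u r))
      + r ^ 2 * Real.exp (ν u r + lam u r) *
        (du ρ u r * (κ / 2 * Real.exp (-κ * ρ u r) * Rstar κ f I (ρ u r)
            - 2 * κ * Real.exp (-κ * ρ u r) ^ 2 *
              (Vstar κ f I (ρ u r) + 8 * Real.pi * U (φ u r)))
          + 8 * Real.pi * Real.exp (-κ * ρ u r) ^ 2 * deriv U (φ u r) * du φ u r)
      - (1 - r ^ 2 * Real.exp (-κ * ρ u r) ^ 2 *
          (Vstar κ f I (ρ u r) + 8 * Real.pi * U (φ u r))) *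
        Real.exp (ν u r + lam u r) * (du ν u r + du lam u r) = 0 := by
  have ho := h.isOpen
  have hν := hasDerivAt_du two_ne_zero ho h.smooth_ν hx
  have hl := hasDerivAt_du two_ne_zero ho h.smooth_lam hx
  have hρ := hasDerivAt_du two_ne_zero ho h.smooth_ρ hx
  have hφ := hasDerivAt_du two_ne_zero ho h.smooth_φ hx
  have hνr := hasDerivAt_du one_ne_zero ho (contDiffOn_dr ho h.smooth_ν) hx
  have hlr := hasDerivAt_du one_ne_zero ho (contDiffOn_dr ho h.smooth_lam) hx
  have hV := (h.hasDerivAt_Vstar_ρ hI hf hx).comp u hρ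
  have hUφ := (hU (φ u r)).hasDerivAt.comp u hφ
  have hA := (hν.sub hl).exp
  have hd := (hA.add ((hA.mul (hνr.sub hlr)).const_mul r)).sub
    (((((hρ.const_mul (-2 * κ)).exp.const_mul (r ^ 2)).mul
      (hV.add (hUφ.const_mul (8 * Real.pi)))).const_sub 1).mul (hν.add hl).exp)
  have h0 := deriv_eq_zero_of_vanish_u ho hx hD hd
  simp only [Pi.add_apply, Pi.sub_apply, Pi.mul_apply, Function.comp_apply,
    exp_neg_two_kappa] at h0
  have hE := exp_neg_two_kappa_mul κ (ρ u r)
  linear_combination h0 - r ^ 2 * Real.exp (ν u r + lam u r) * du ρ u r * κ / 2 *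
    Rstar κ f I (ρ u r) * hE

theorem radialDiff_dr (h : BondiFrame κ I f Ω ν lam ρ φ g) (hI : IsOpen I)
    (hf : ContDiffOn ℝ 2 f I) (hU : Differentiable ℝ U)
    (hD : ∀ u r, (u, r) ∈ Ω → radialDiffRes κ f U I ν lam ρ φ u r = 0) (hx : (u, r) ∈ Ω) :
    Real.exp (ν u r - lam u r) * ((dr ν u r - dr lam u r) * (2 + r * (dr ν u r - dr lam u r))
        + r * (dr (dr ν) u r - dr (dr lam) u r))
      + r ^ 2 * Real.exp (ν u r + lam u r) *
        (dr ρ u r * (κ / 2 * Real.exp (-κ * ρ u r) * Rstar κ f I (ρ u r)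
            - 2 * κ * Real.exp (-κ * ρ u r) ^ 2 *
              (Vstar κ f I (ρ u r) + 8 * Real.pi * U (φ u r)))
          + 8 * Real.pi * Real.exp (-κ * ρ u r) ^ 2 * deriv U (φ u r) * dr φ u r)
      + 2 * r * Real.exp (ν u r + lam u r) * Real.exp (-κ * ρ u r) ^ 2 *
          (Vstar κ f I (ρ u r) + 8 * Real.pi * U (φ u r))
      - (1 - r ^ 2 * Real.exp (-κ * ρ u r) ^ 2 *
          (Vstar κ f I (ρ u r) + 8 * Real.pi * U (φ u r))) *
        Real.exp (ν u r + lam u r) * (dr ν u r + dr lam u r) = 0 := by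
  have ho := h.isOpen
  have hν := hasDerivAt_dr two_ne_zero ho h.smooth_ν hx
  have hl := hasDerivAt_dr two_ne_zero ho h.smooth_lam hx
  have hρ := hasDerivAt_dr two_ne_zero ho h.smooth_ρ hx
  have hφ := hasDerivAt_dr two_ne_zero ho h.smooth_φ hx
  have hνr := hasDerivAt_dr one_ne_zero ho (contDiffOn_dr ho h.smooth_ν) hx
  have hlr := hasDerivAt_dr one_ne_zero ho (contDiffOn_dr ho h.smooth_lam) hx
  have hV := (h.hasDerivAt_Vstar_ρ hI hf hx).comp r hρ
  have hUφ := (hU (φ u r)).hasDerivAt.comp r hφ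
  have hA := (hν.sub hl).exp
  have hd := (hA.add ((hasDerivAt_id' r).mul (hA.mul (hνr.sub hlr)))).sub
    (((((hasDerivAt_pow 2 r).mul (hρ.const_mul (-2 * κ)).exp).mul
      (hV.add (hUφ.const_mul (8 * Real.pi)))).const_sub 1).mul (hν.add hl).exp)
  have h0 := deriv_eq_zero_of_vanish_r ho hx hD hd
  simp only [Pi.add_apply, Pi.sub_apply, Pi.mul_apply, Function.comp_apply,
    exp_neg_two_kappa] at h0
  have hE := exp_neg_two_kappa_mul κ (ρ u r)
  push_cast at h0
  linear_combination h0 - r ^ 2 * Real.exp (ν u r + lam u r) * dr ρ u r * κ / 2 *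
    Rstar κ f I (ρ u r) * hE

/-! ### The contracted Bianchi identity in Bondi coordinates -/

/-- Multiplying by `κ` clears the denominators of (4), and `W_⋆` is expressed through `R_⋆` and
`V_⋆`, so that the Bianchi identities become polynomial. -/
theorem kappa_mul_transportRhoRes (h : BondiFrame κ I f Ω ν lam ρ φ g) (hx : (u, r) ∈ Ω) :
    κ * transportRhoRes κ f U I ν lam ρ φ u r =
      κ * transport ν lam u r ρ
        - κ / 2 * (Real.exp (ν u r + lam u r) - Real.exp (ν u r - lam u r)
          - r ^ 2 * Real.exp (ν u r + lam u r) * Real.exp (-κ * ρ u r) ^ 2 *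
            (Vstar κ f I (ρ u r) + 8 * Real.pi * U (φ u r))) * dr ρ u r
        + 8 * Real.pi * r / 3 * Real.exp (-κ * ρ u r) * dr φ u r * lightD ν lam φ u r
        + r * Real.exp (ν u r + lam u r) * (Rstar κ f I (ρ u r) * Real.exp (-κ * ρ u r) / 6
          - 2 / 3 * Vstar κ f I (ρ u r) * Real.exp (-κ * ρ u r) ^ 2
          - 16 / 3 * Real.pi * Real.exp (-κ * ρ u r) ^ 2 * U (φ u r)) := by
  have hκ := h.pos.ne'
  have hW : Wstar κ f I (ρ u r) = (Rstar κ f I (ρ u r) * Real.exp (-κ * ρ u r)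
      - 4 * Vstar κ f I (ρ u r) * Real.exp (-2 * κ * ρ u r)) / 6 := h.Wstar_eq (mem_chart_equator hx)
  have hA : Real.exp (ν u r + lam u r) * Real.exp (-2 * lam u r) = Real.exp (ν u r - lam u r) := by
    rw [← Real.exp_add]; congr 1; ring
  rw [transportRhoRes, hW, exp_neg_two_kappa, ← hA]
  field_simp
  ring

/-- The divergence of `E` would involve third derivatives, but `lightRes` is of first order and can
be differentiated once. The second derivatives of `ν` and `lam` that appear are removed by `∂_u` and
`∂_r` of (1) and `∂_u` of (2). The factor `∂_uρ` enters because the logarithm of the area radius of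
`g` has `u`-derivative `-(κ/2) ∂_uρ`. -/
theorem hasDerivAt_lightRes (h : BondiFrame κ I f Ω ν lam ρ φ g) (hI : IsOpen I)
    (hf : ContDiffOn ℝ 2 f I) (hU : Differentiable ℝ U)
    (hS : ∀ u r, (u, r) ∈ Ω → radialSumRes κ ν lam ρ φ u r = 0)
    (hD : ∀ u r, (u, r) ∈ Ω → radialDiffRes κ f U I ν lam ρ φ u r = 0) (hx : (u, r) ∈ Ω) :
    HasDerivAt (fun t => lightRes κ ν lam ρ φ u t)
      (-(3 * κ ^ 2 * r * du ρ u r * transportRhoRes κ f U I ν lam ρ φ u r)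
        - 16 * Real.pi * Real.exp (-κ * ρ u r) * r * du φ u r *
          transportPhiRes κ U ν lam ρ φ u r) r := by
  have ho := h.isOpen
  have hν := hasDerivAt_dr two_ne_zero ho h.smooth_ν hx
  have hl := hasDerivAt_dr two_ne_zero ho h.smooth_lam hx
  have hρ := hasDerivAt_dr two_ne_zero ho h.smooth_ρ hx
  have hνr := hasDerivAt_dr one_ne_zero ho (contDiffOn_dr ho h.smooth_ν) hx
  have hlr := hasDerivAt_dr one_ne_zero ho (contDiffOn_dr ho h.smooth_lam) hx
  have hρr := hasDerivAt_dr one_ne_zero ho (contDiffOn_dr ho h.smooth_ρ) hx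
  have hφr := hasDerivAt_dr one_ne_zero ho (contDiffOn_dr ho h.smooth_φ) hx
  have hlu := hasDerivAt_dr one_ne_zero ho (contDiffOn_du ho h.smooth_lam) hx
  have hρu := hasDerivAt_dr one_ne_zero ho (contDiffOn_du ho h.smooth_ρ) hx
  have hφu := hasDerivAt_dr one_ne_zero ho (contDiffOn_du ho h.smooth_φ) hx
  rw [dr_du_eq_du_dr ho h.smooth_lam hx] at hlu
  rw [dr_du_eq_du_dr ho h.smooth_ρ hx] at hρu
  rw [dr_du_eq_du_dr ho h.smooth_φ hx] at hφu
  have hA := (hν.sub hl).exp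
  have hDρ := hρu.sub ((hA.const_mul (1 / 2)).mul hρr)
  have hDφ := hφu.sub ((hA.const_mul (1 / 2)).mul hφr)
  have hd := ((hasDerivAt_id' r).mul (hA.mul (((hA.div_const 2).mul (hνr.add hlr)).sub
    (hlu.const_mul 2)))).sub ((hasDerivAt_pow 2 r).mul
      (((hDρ.pow 2).const_mul (3 / 2 * κ ^ 2)).add
        (((hρ.const_mul (-κ)).exp.const_mul (8 * Real.pi)).mul (hDφ.pow 2))))
  refine HasDerivAt.congr_deriv hd ?_
  have hSu := h.radialSum_du hS hx
  have hSr := h.radialSum_dr hS hx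
  have hDu := h.radialDiff_du hI hf hU hD hx
  have hS0 := hS u r hx
  have hD0 := hD u r hx
  have hT := h.kappa_mul_transportRhoRes (U := U) hx
  have hexp : Real.exp (ν u r + lam u r - κ * ρ u r) =
      Real.exp (ν u r + lam u r) * Real.exp (-κ * ρ u r) := by
    rw [← Real.exp_add]; congr 1; ring
  simp only [radialSumRes] at hS0
  simp only [radialDiffRes, exp_neg_two_kappa] at hD0
  simp only [transport, lightD] at hT
  simp only [transportPhiRes, transport, lightD, hexp, Pi.add_apply, Pi.sub_apply, Pi.mul_apply,
    Pi.pow_apply]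
  push_cast
  -- From here the exponentials are independent symbols: the identity is polynomial in them and the
  -- derivatives.
  generalize transportRhoRes κ f U I ν lam ρ φ u r = T at hT ⊢
  generalize Real.exp (ν u r - lam u r) = a at *
  generalize Real.exp (ν u r + lam u r) = b at *
  generalize Real.exp (-κ * ρ u r) = E at *
  -- The first two terms together produce `-2 r a ∂_u∂_r lam`, and the third the radial second
  -- derivatives; the multiples of `hS0` and `hD0` absorb what remains of first order.
  linear_combination hDu - r * a * hSu + r * a ^ 2 / 2 * hSr
    + (a ^ 2 / 2 + r * a ^ 2 * (dr ν u r - dr lam u r)) * hS0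
    + (-(a / 2) * (dr ν u r + dr lam u r)
      - (du ν u r + du lam u r - a / 2 * (dr ν u r + dr lam u r))
      + 3 / 2 * κ ^ 2 * r * du ρ u r * dr ρ u r) * hD0
    + 3 * κ * r * du ρ u r * hT

/-- The equality `R_⋆(ρ) = R` with denominators cleared; it is the second-order relation between `ρ`
and the metric needed for the radial Bianchi component. -/
theorem Rstar_bondi (h : BondiFrame κ I f Ω ν lam ρ φ g) (hx : (u, r) ∈ Ω) :
    r ^ 2 * Real.exp (ν u r + lam u r) * Real.exp (-κ * ρ u r) * Rstar κ f I (ρ u r) =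
      2 * r ^ 2 * (du (dr ν) u r + du (dr lam) u r)
        - 4 * r * Real.exp (ν u r - lam u r) * (dr ν u r - dr lam u r)
        - 2 * r ^ 2 * Real.exp (ν u r - lam u r) *
          (dr (dr ν) u r + dr ν u r * (dr ν u r - dr lam u r))
        + 2 * (Real.exp (ν u r + lam u r) - Real.exp (ν u r - lam u r))
        - 6 * κ * r * (transport ν lam u r ρ
          - r / 2 * Real.exp (ν u r - lam u r) * (dr ν u r - dr lam u r) * dr ρ u r)
        + 3 * κ ^ 2 * r ^ 2 * lightD ν lam ρ u r * dr ρ u r := by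
  have hc := mem_chart_equator hx
  have hr := h.radius_pos _ _ hx
  have hp := Real.exp_ne_zero (ν u r)
  have hq := Real.exp_ne_zero (lam u r)
  have hh := Real.exp_ne_zero (κ / 2 * ρ u r)
  obtain ⟨e1, e2, -, -⟩ := exp_kappa κ (ρ u r)
  have hR : Rstar κ f I (ρ u r) = _ := (h.Rstar_eq hc).trans
    ((scalarCurvature_congr (isOpen_chart h.isOpen) h.g_eq hc).trans (h.scalarCurvature_eq hc))
  simp only [Matrix.cons_val_zero, Matrix.cons_val_one] at hR
  rw [hR]
  simp only [transport, lightD, Real.exp_add, Real.exp_sub, Real.exp_neg, exp_two_mul,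
    exp_neg_two_mul, e1, e2]
  field_simp
  ring

/-- The `r` component of the Bianchi identity. Because `g^{uu} = 0` and `Γ^u_{ar} = 0`, the
component `X(D, D)` is absent from it, so (1), (2), (4) and `R_⋆(ρ) = R` suffice. -/
theorem dr_mul_transportPhiRes (h : BondiFrame κ I f Ω ν lam ρ φ g) (hI : IsOpen I)
    (hf : ContDiffOn ℝ 2 f I) (hU : Differentiable ℝ U)
    (hS : ∀ u r, (u, r) ∈ Ω → radialSumRes κ ν lam ρ φ u r = 0)
    (hD : ∀ u r, (u, r) ∈ Ω → radialDiffRes κ f U I ν lam ρ φ u r = 0) (hx : (u, r) ∈ Ω)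
    (hT0 : transportRhoRes κ f U I ν lam ρ φ u r = 0) :
    16 * Real.pi * r ^ 2 * Real.exp (-κ * ρ u r) * dr φ u r *
      transportPhiRes κ U ν lam ρ φ u r = 0 := by
  have hSu := h.radialSum_du hS hx
  have hSr := h.radialSum_dr hS hx
  have hDr := h.radialDiff_dr hI hf hU hD hx
  have hS0 := hS u r hx
  have hD0 := hD u r hx
  have hT := h.kappa_mul_transportRhoRes (U := U) hx
  have hR := h.Rstar_bondi hx
  have hκ := h.pos.ne'
  have hr := (h.radius_pos _ _ hx).ne'
  have hexp : Real.exp (ν u r + lam u r - κ * ρ u r) =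
      Real.exp (ν u r + lam u r) * Real.exp (-κ * ρ u r) := by
    rw [← Real.exp_add]; congr 1; ring
  rw [hT0] at hT
  simp only [radialSumRes] at hS0
  simp only [radialDiffRes, exp_neg_two_kappa] at hD0
  simp only [transport, lightD] at hT hR
  simp only [transportPhiRes, transport, lightD, hexp]
  generalize Real.exp (ν u r - lam u r) = a at *
  generalize Real.exp (ν u r + lam u r) = b at *
  generalize Real.exp (-κ * ρ u r) = E at *
  -- The coefficient of `hT` is `-6 r²` times the radial derivative of `log r - κρ/2`; `κ ∂_rρ / 2`
  -- times it, within the coefficient of `hD0`, trades the right side of (2) in (4) for `∂_r(r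
  -- e^{ν-lam})`.
  linear_combination -hR - 2 * r ^ 2 * hSu + r ^ 2 * a * hSr + r * hDr
    + (r ^ 2 * a * (dr ν u r - dr lam u r) + r * (a + r * a * (dr ν u r - dr lam u r))) * hS0
    + (2 - r * (dr ν u r + dr lam u r)
      + (3 * κ ^ 2 * dr ρ u r * r ^ 2 - 6 * κ * r) * dr ρ u r / 2) * hD0
    + (3 * κ * dr ρ u r * r ^ 2 - 6 * r) * hT

end BondiFrame

namespace BondiFrame

variable {κ : ℝ} {I : Set ℝ} {f U : ℝ → ℝ} {Ω : Set (ℝ × ℝ)} {ν lam ρ φ : ℝ → ℝ → ℝ}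
  {g : TensorField} {u r : ℝ}

/-! ### Consequences of the field equations, and the equation at the center -/

/-- Where `∂_uφ ≠ 0` the vanishing of `lightRes` on `Ω` is differentiated in `r`; where `∂_rφ ≠ 0`
the radial Bianchi component applies. -/
theorem transportPhiRes_eq_zero (h : BondiFrame κ I f Ω ν lam ρ φ g) (hI : IsOpen I)
    (hf : ContDiffOn ℝ 2 f I) (hU : Differentiable ℝ U)
    (hS : ∀ u r, (u, r) ∈ Ω → radialSumRes κ ν lam ρ φ u r = 0)
    (hD : ∀ u r, (u, r) ∈ Ω → radialDiffRes κ f U I ν lam ρ φ u r = 0)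
    (hT : ∀ u r, (u, r) ∈ Ω → transportRhoRes κ f U I ν lam ρ φ u r = 0)
    (hQ : ∀ u r, (u, r) ∈ Ω → lightRes κ ν lam ρ φ u r = 0) (hx : (u, r) ∈ Ω)
    (hφ : du φ u r ≠ 0 ∨ dr φ u r ≠ 0) : transportPhiRes κ U ν lam ρ φ u r = 0 := by
  have hr := (h.radius_pos _ _ hx).ne'
  rcases hφ with hφ | hφ
  · have h1 := deriv_eq_zero_of_vanish_r h.isOpen hx hQ (h.hasDerivAt_lightRes hI hf hU hS hD hx)
    rw [hT u r hx] at h1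
    simpa [hr, hφ, Real.pi_ne_zero] using h1
  · have h1 := h.dr_mul_transportPhiRes hI hf hU hS hD hx (hT u r hx)
    simpa [hr, hφ, Real.pi_ne_zero] using h1

/-- Under the essential equations `∂_r lightRes = 0`, so the value at `(u, r)` is carried along the
ray down to the center, where regularity makes it vanish. -/
theorem lightRes_eq_zero (h : BondiFrame κ I f Ω ν lam ρ φ g) (hI : IsOpen I)
    (hf : ContDiffOn ℝ 2 f I) (hU : Differentiable ℝ U)
    (hcenter : ∀ u r s, (u, r) ∈ Ω → 0 < s → s ≤ r → (u, s) ∈ Ω)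
    (hreg : RegularAtCenter κ f U Ω ν lam ρ φ g)
    (hS : ∀ u r, (u, r) ∈ Ω → radialSumRes κ ν lam ρ φ u r = 0)
    (hD : ∀ u r, (u, r) ∈ Ω → radialDiffRes κ f U I ν lam ρ φ u r = 0)
    (hP : ∀ u r, (u, r) ∈ Ω → transportPhiRes κ U ν lam ρ φ u r = 0)
    (hT : ∀ u r, (u, r) ∈ Ω → transportRhoRes κ f U I ν lam ρ φ u r = 0)
    (hx : (u, r) ∈ Ω) : lightRes κ ν lam ρ φ u r = 0 := by
  have hr := h.radius_pos _ _ hx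
  have hd : ∀ t, (u, t) ∈ Ω → HasDerivAt (fun t => lightRes κ ν lam ρ φ u t) 0 t := fun t ht => by
    simpa [hP u t ht, hT u t ht] using h.hasDerivAt_lightRes hI hf hU hS hD ht
  have hconst : ∀ s ∈ Ioo 0 r, lightRes κ ν lam ρ φ u s = lightRes κ ν lam ρ φ u r := by
    intro s hs
    have hmem : ∀ t ∈ Icc s r, (u, t) ∈ Ω := fun t ht =>
      hcenter u r t hx (hs.1.trans_le ht.1) ht.2
    exact (constant_of_has_deriv_right_zero (f := fun t => lightRes κ ν lam ρ φ u t)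
      (fun t ht => (hd t (hmem t ht)).continuousAt.continuousWithinAt)
      (fun t ht => (hd t (hmem t ⟨ht.1, ht.2.le⟩)).hasDerivWithinAt) r ⟨hs.2.le, le_rfl⟩).symm
  have hlim := hreg u ⟨r, hx⟩ (Real.pi / 2) ⟨by simp [Real.pi_pos], by simp [Real.pi_pos]⟩ 0
  -- The weight `s² e^{-κρ}` exactly cancels the factor `e^{κρ} / s²` in `X(D, D)`, so near the
  -- center the quantity in the regularity condition is already constant.
  have hev : (fun _ : ℝ => lightRes κ ν lam ρ φ u r) =ᶠ[𝓝[>] 0] fun s : ℝ =>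
      s ^ 2 * Real.exp (-κ * ρ u s) *
        (comp (modGravity f g ![u, s, Real.pi / 2, 0]) (vecD ν lam ![u, s, Real.pi / 2, 0])
            (vecD ν lam ![u, s, Real.pi / 2, 0])
          - 8 * Real.pi * comp (stressEnergy U g (lift φ) ![u, s, Real.pi / 2, 0])
              (vecD ν lam ![u, s, Real.pi / 2, 0]) (vecD ν lam ![u, s, Real.pi / 2, 0])) := by
    filter_upwards [Ioo_mem_nhdsGT hr] with s hs
    have hc := mem_chart_equator (hcenter u r s hx hs.1 hs.2.le)
    have hs0 := hs.1.ne'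
    have hcomp : comp (fieldResidual f U g φ ![u, s, Real.pi / 2, 0])
        (vecD ν lam ![u, s, Real.pi / 2, 0]) (vecD ν lam ![u, s, Real.pi / 2, 0]) =
          Real.exp (κ * ρ u s) / s ^ 2 * lightRes κ ν lam ρ φ u s := h.comp_light U hc
    have hE : Real.exp (-κ * ρ u s) * Real.exp (κ * ρ u s) = 1 := by
      rw [← Real.exp_add]; simp
    rw [← comp_fieldResidual, hcomp, ← hconst s hs]
    have hs2 : s ^ 2 * (s ^ 2)⁻¹ = 1 := mul_inv_cancel₀ (pow_ne_zero 2 hs0)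
    linear_combination (-lightRes κ ν lam ρ φ u s) * (s ^ 2 * (s ^ 2)⁻¹ * hE + hs2)
  exact tendsto_nhds_unique (tendsto_const_nhds.congr' hev) hlim

theorem essentialEquations_iff (h : BondiFrame κ I f Ω ν lam ρ φ g) :
    EssentialEquations κ f U I Ω ν lam ρ φ ↔
      (∀ u r, (u, r) ∈ Ω → radialSumRes κ ν lam ρ φ u r = 0) ∧
      (∀ u r, (u, r) ∈ Ω → radialDiffRes κ f U I ν lam ρ φ u r = 0) ∧
      (∀ u r, (u, r) ∈ Ω → transportPhiRes κ U ν lam ρ φ u r = 0) ∧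
      (∀ u r, (u, r) ∈ Ω → transportRhoRes κ f U I ν lam ρ φ u r = 0) := by
  constructor
  · intro he
    exact ⟨fun u r hx => (h.radialSum_iff hx).1 (he u r hx).1,
      fun u r hx => (h.radialDiff_iff U hx).1 (he u r hx).2.1,
      fun u r hx => (h.transportPhi_iff U hx).1 (he u r hx).2.2.1,
      fun u r hx => (h.transportRho_iff U hx).1 (he u r hx).2.2.2⟩
  · rintro ⟨hS, hD, hP, hT⟩ u r hx
    exact ⟨(h.radialSum_iff hx).2 (hS u r hx), (h.radialDiff_iff U hx).2 (hD u r hx),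
      (h.transportPhi_iff U hx).2 (hP u r hx), (h.transportRho_iff U hx).2 (hT u r hx)⟩

theorem fieldEquations_iff (h : BondiFrame κ I f Ω ν lam ρ φ g) :
    (∀ x ∈ chart Ω, FieldEquationsAt f U g φ x) ↔
      (∀ u r, (u, r) ∈ Ω → radialSumRes κ ν lam ρ φ u r = 0) ∧
      (∀ u r, (u, r) ∈ Ω → radialDiffRes κ f U I ν lam ρ φ u r = 0) ∧
      (∀ u r, (u, r) ∈ Ω → transportRhoRes κ f U I ν lam ρ φ u r = 0) ∧
      (∀ u r, (u, r) ∈ Ω → lightRes κ ν lam ρ φ u r = 0) := by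
  constructor
  · intro he
    have key := fun u r (hx : (u, r) ∈ Ω) =>
      (h.fieldEquationsAt_iff U (mem_chart_equator hx)).1 (he _ (mem_chart_equator hx))
    exact ⟨fun u r hx => (key u r hx).1, fun u r hx => (key u r hx).2.1,
      fun u r hx => (key u r hx).2.2.1, fun u r hx => (key u r hx).2.2.2⟩
  · rintro ⟨hS, hD, hT, hQ⟩ x hx
    exact (h.fieldEquationsAt_iff U hx).2
      ⟨hS _ _ hx.1, hD _ _ hx.1, hT _ _ hx.1, hQ _ _ hx.1⟩

theorem kleinGordon_iff (h : BondiFrame κ I f Ω ν lam ρ φ g) :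
    (∀ x ∈ chart Ω, KleinGordonAt U g φ x) ↔
      ∀ u r, (u, r) ∈ Ω → transportPhiRes κ U ν lam ρ φ u r = 0 :=
  ⟨fun he _ _ hx => (h.kleinGordonAt_iff U (mem_chart_equator hx)).1 (he _ (mem_chart_equator hx)),
    fun he _ hx => (h.kleinGordonAt_iff U hx).2 (he _ _ hx.1)⟩

end BondiFrame

end FRBondi

end

/-! ### The proposition -/

theorem proposition2p1
    (κ : ℝ) (hκ : 0 < κ)
    -- the function `f`, on an open set `I` of values of the scalar curvature, and the potential
    (I : Set ℝ) (hI : IsOpen I) (f U : ℝ → ℝ) (hf : ContDiffOn ℝ 2 f I)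
    (hf_pos : ∀ R ∈ I, 0 < deriv f R) (hf_inj : Set.InjOn (deriv f) I)
    (hU : Differentiable ℝ U)
    -- the region of the `(u, r)` plane, which reaches the center `r = 0`
    (Ω : Set (ℝ × ℝ)) (hΩ : IsOpen Ω) (hΩ_pos : ∀ u r, (u, r) ∈ Ω → 0 < r)
    (hΩ_center : ∀ u r s, (u, r) ∈ Ω → 0 < s → s ≤ r → (u, s) ∈ Ω)
    (ν lam ρ φ : ℝ → ℝ → ℝ)
    (hν : ContDiffOn ℝ 2 (Function.uncurry ν) Ω)
    (hlam : ContDiffOn ℝ 2 (Function.uncurry lam) Ω)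
    (hρ : ContDiffOn ℝ 2 (Function.uncurry ρ) Ω)
    (hφ : ContDiffOn ℝ 2 (Function.uncurry φ) Ω)
    -- the physical metric `g`, with `ρ = (1/κ) log f'(R)` and `e^{κρ} g` in Bondi form
    (g : FRBondi.TensorField)
    (hg : ∀ x ∈ FRBondi.chart Ω,
      Real.exp (κ * FRBondi.lift ρ x) • g x = FRBondi.bondiMetric ν lam x)
    (hR : ∀ x ∈ FRBondi.chart Ω, FRBondi.scalarCurvature g x ∈ I)
    (hρR : ∀ x ∈ FRBondi.chart Ω,
      FRBondi.lift ρ x = 1 / κ * Real.log (deriv f (FRBondi.scalarCurvature g x))) :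
    -- the components `(n, l)` and `(l, l)` are the two radial equations
    (∀ x ∈ FRBondi.chart Ω,
      (FRBondi.ComponentAt f U g φ x (FRBondi.vecN ν lam x) (FRBondi.vecL lam x) ∧
        FRBondi.ComponentAt f U g φ x (FRBondi.vecL lam x) (FRBondi.vecL lam x)) ↔
      (FRBondi.RadialSum κ ν lam ρ φ (x 0) (x 1) ∧
        FRBondi.RadialDiff κ f U I ν lam ρ φ (x 0) (x 1))) ∧
    -- the Klein-Gordon equation is the transport equation for `φ`
    (∀ x ∈ FRBondi.chart Ω,
      FRBondi.KleinGordonAt U g φ x ↔ FRBondi.TransportPhi κ U ν lam ρ φ (x 0) (x 1)) ∧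
    -- given the second radial equation, the trace is the transport equation for `ρ`
    (∀ x ∈ FRBondi.chart Ω, FRBondi.RadialDiff κ f U I ν lam ρ φ (x 0) (x 1) →
      (FRBondi.TraceAt f U g φ x ↔ FRBondi.TransportRho κ f U I ν lam ρ φ (x 0) (x 1))) ∧
    -- the scalar curvature of `g` in terms of `ν`, `lam`, `ρ`
    (∀ x ∈ FRBondi.chart Ω,
      FRBondi.scalarCurvature g x = Real.exp (κ * ρ (x 0) (x 1)) *
        (FRBondi.scalarBondi ν lam (x 0) (x 1)
          + 3 * κ * FRBondi.boxBondi ν lam ρ (x 0) (x 1)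
          + 3 * κ ^ 2 * Real.exp (-ν (x 0) (x 1) - lam (x 0) (x 1)) *
            FRBondi.lightD ν lam ρ (x 0) (x 1) * FRBondi.dr ρ (x 0) (x 1))) ∧
    -- the tensorial field equations alone imply the radial equations, the transport equation
    -- for `ρ`, and the transport equation for `φ` wherever `dφ ≠ 0`
    ((∀ x ∈ FRBondi.chart Ω, FRBondi.FieldEquationsAt f U g φ x) →
      ∀ u r, (u, r) ∈ Ω →
        FRBondi.RadialSum κ ν lam ρ φ u r ∧ FRBondi.RadialDiff κ f U I ν lam ρ φ u r ∧
        FRBondi.TransportRho κ f U I ν lam ρ φ u r ∧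
        ((FRBondi.du φ u r ≠ 0 ∨ FRBondi.dr φ u r ≠ 0) →
          FRBondi.TransportPhi κ U ν lam ρ φ u r)) ∧
    -- the full system implies the essential equations
    ((∀ x ∈ FRBondi.chart Ω,
        FRBondi.FieldEquationsAt f U g φ x ∧ FRBondi.KleinGordonAt U g φ x) →
      FRBondi.EssentialEquations κ f U I Ω ν lam ρ φ) ∧
    -- under the regularity condition at the center, the essential equations imply the remaining
    -- components, and are equivalent to the full system
    (FRBondi.RegularAtCenter κ f U Ω ν lam ρ φ g →
      (FRBondi.EssentialEquations κ f U I Ω ν lam ρ φ →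
        ∀ x ∈ FRBondi.chart Ω,
          FRBondi.ComponentAt f U g φ x (FRBondi.vecN ν lam x) (FRBondi.vecN ν lam x) ∧
          FRBondi.ComponentAt f U g φ x (FRBondi.vecZ₁ x) (FRBondi.vecZ₁ x) ∧
          FRBondi.ComponentAt f U g φ x (FRBondi.vecZ₂ x) (FRBondi.vecZ₂ x)) ∧
      ((∀ x ∈ FRBondi.chart Ω,
          FRBondi.FieldEquationsAt f U g φ x ∧ FRBondi.KleinGordonAt U g φ x) ↔
        FRBondi.EssentialEquations κ f U I Ω ν lam ρ φ)) := by
  have h : FRBondi.BondiFrame κ I f Ω ν lam ρ φ g :=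
    ⟨hκ, hf_pos, hf_inj, hΩ, hΩ_pos, hν, hlam, hρ, hφ, hg, hR, hρR⟩
  -- This direction needs no condition at the center, and serves both as a claim of its own and as
  -- half of the final equivalence.
  have hfull : (∀ x ∈ FRBondi.chart Ω,
      FRBondi.FieldEquationsAt f U g φ x ∧ FRBondi.KleinGordonAt U g φ x) →
      FRBondi.EssentialEquations κ f U I Ω ν lam ρ φ := fun hE => by
    obtain ⟨hS, hD, hT, -⟩ := h.fieldEquations_iff.1 fun x hx => (hE x hx).1
    exact h.essentialEquations_iff.2
      ⟨hS, hD, h.kleinGordon_iff.1 fun x hx => (hE x hx).2, hT⟩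
  refine ⟨fun x hx => ?_, fun x hx => ?_, fun x hx hD => ?_,
    fun x hx => h.scalarCurvature_bondi hx, fun hE u r hx => ?_, hfull,
    fun hreg => ⟨fun hE x hx => ?_, hfull, fun hE => ?_⟩⟩
  · rw [h.vecN_vecL_iff U hx, h.vecL_vecL_iff U hx, h.radialSum_iff hx.1, h.radialDiff_iff U hx.1,
      and_comm]
  · rw [h.kleinGordonAt_iff U hx, h.transportPhi_iff U hx.1]
  · rw [h.traceAt_iff_transportRho U hx ((h.radialDiff_iff U hx.1).1 hD),
      h.transportRho_iff U hx.1]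
  · obtain ⟨hS, hD, hT, hQ⟩ := h.fieldEquations_iff.1 hE
    exact ⟨(h.radialSum_iff hx).2 (hS u r hx), (h.radialDiff_iff U hx).2 (hD u r hx),
      (h.transportRho_iff U hx).2 (hT u r hx), fun hdφ => (h.transportPhi_iff U hx).2
        (h.transportPhiRes_eq_zero hI hf hU hS hD hT hQ hx hdφ)⟩
  · obtain ⟨hS, hD, hP, hT⟩ := h.essentialEquations_iff.1 hE
    -- The angular components follow pointwise from the trace; only the `(n, n)` component requires
    -- the regularity condition.
    obtain ⟨-, -, h22⟩ := h.fieldResidual_eq_zero hx (hS _ _ hx.1) (hD _ _ hx.1) (hT _ _ hx.1)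
    exact ⟨(h.vecN_vecN_iff U hx).2
        (h.lightRes_eq_zero hI hf hU hΩ_center hreg hS hD hP hT hx.1),
      (h.vecZ₁_iff U hx).2 h22, (h.vecZ₂_iff U hx).2 h22⟩
  · obtain ⟨hS, hD, hP, hT⟩ := h.essentialEquations_iff.1 hE
    have hF := h.fieldEquations_iff.2 ⟨hS, hD, hT, fun u r hx =>
      h.lightRes_eq_zero hI hf hU hΩ_center hreg hS hD hP hT hx⟩
    exact fun x hx => ⟨hF x hx, h.kleinGordon_iff.2 hP x hx⟩
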